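/- Let $N\ge 2$ be an integer and $\alpha\in(0,2)$. Write points of $\mathbb R^{2N}$ as $(\mathbf x_1,\dots,\mathbf x_N)$ with $\mathbf x_j\in\mathbb R^2$, put $(x,y)^\perp=(-y,x)$, and for $1\le j\le N$ let $$D_j=-\mathrm i\nabla_{\mathbf x_j}+\alpha\mathbf A_j,\qquad \mathbf A_j=\sum_{k\ne j}\frac{(\mathbf x_j-\mathbf x_k)^\perp}{|\mathbf x_j-\mathbf x_k|^2},$$ acting in the sense of distributions on $\mathbb R^{2N}\setminus\{\mathbf x_j=\mathbf x_l\text{ for some }j\ne l\}$. Let $$C_\alpha=2\min_{q\in\mathbb Z}|\alpha-2q|^2 .$$ Let $\phi\in L^2(\mathbb R^{2N};\mathbb C)$ be symmetric under all permutations of $\mathbf x_1,\dots,\mathbf x_N$, and suppose that $D_j\phi\in L^2(\mathbb R^{2N};\mathbb C^2)$ for every $j$. Then $\int_{\mathbb R^{2N}}|\phi|^2/|\mathbf x_j-\mathbf x_l|^2<\infty$ for all $j<l$, and $$\sum_{k=1}^N\int_{\mathbb R^{2N}}|D_k\phi|^2\;\ge\;\frac{2C_\alpha}{(N-1)\bigl(2+3(N-2)C_\alpha\bigr)}\sum_{1\le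 j<l\le N}\int_{\mathbb R^{2N}}\frac{|\phi|^2}{|\mathbf x_j-\mathbf x_l|^2}.$$ -/

import Mathlib

open MeasureTheory
open scoped ContDiff

noncomputable section

namespace Anyon

/-- The Euclidean plane `ℝ²`. -/
abbrev Plane : Type := EuclideanSpace ℝ (Fin 2)

/-- The configuration space `ℝ^{2N} = (ℝ²)^N` of `N` particles in the plane. Its `volume` is
Lebesgue measure; the norm of this type is never used for anything but its topology. -/
abbrev Config (N : ℕ) : Type := Fin N → Plane

/-- `𝐱^⊥ = (-y, x)` for `𝐱 = (x, y)`. -/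
def perp (v : Plane) : Plane := !₂[-v 1, v 0]

/-- The diagonals: configurations in which two different particles sit at the same point. -/
def diagonals (N : ℕ) : Set (Config N) := {x | ∃ j l, j ≠ l ∧ x j = x l}

/-- The vector potential `𝐀_j = ∑_{k ≠ j} (𝐱_j - 𝐱_k)^⊥ / |𝐱_j - 𝐱_k|²`, a function of the whole
configuration. -/
def vectorPotential {N : ℕ} (j : Fin N) (x : Config N) : Plane :=
  ∑ k ∈ Finset.univ.erase j, (‖x j - x k‖ ^ 2)⁻¹ • perp (x j - x k)

/-- The classical partial derivative of `ψ` with respect to the `a`-th coordinate of particle `j`. -/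
def partialDeriv {N : ℕ} (j : Fin N) (a : Fin 2) (ψ : Config N → ℂ) (x : Config N) : ℂ :=
  fderiv ℝ ψ x (Pi.single j (EuclideanSpace.single a 1))

/-- Complex-valued test functions in `C_c^∞(ℝ^{2N} ∖ diagonals)`. -/
structure IsTestFunction {N : ℕ} (ψ : Config N → ℂ) : Prop where
  smooth : ContDiff ℝ ∞ ψ
  compact : HasCompactSupport ψ
  support : tsupport ψ ⊆ (diagonals N)ᶜ

/-- `G = D_j φ`, where `D_j = -i ∇_{𝐱_j} + α 𝐀_j`, in the sense of distributions on
`ℝ^{2N} ∖ diagonals` (`𝐀_j` is smooth there). Since the diagonals are a null set, `G` is determined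
by `φ` almost everywhere. -/
def IsMagneticDeriv {N : ℕ} (α : ℝ) (j : Fin N) (φ : Config N → ℂ)
    (G : Config N → EuclideanSpace ℂ (Fin 2)) : Prop :=
  ∀ ψ : Config N → ℂ, IsTestFunction ψ → ∀ a : Fin 2,
    ∫ x, G x a * ψ x =
      ∫ x, φ x * (Complex.I * partialDeriv j a ψ x + ((α * vectorPotential j x a : ℝ) : ℂ) * ψ x)

/-- `φ ∈ L²_sym(ℝ^{2N})`: square integrable and, almost everywhere, invariant under every
permutation of the particles. -/
structure IsSymmetricL2 {N : ℕ} (φ : Config N → ℂ) : Prop where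
  memLp : MemLp φ 2 volume
  symm : ∀ σ : Equiv.Perm (Fin N), (fun x : Config N => φ (x ∘ σ)) =ᵐ[volume] φ

/-- `C_α = 2 min_{q ∈ ℤ} |α - 2q|²`. The infimum is over a set bounded below and is attained. -/
def hardyConst (α : ℝ) : ℝ := 2 * ⨅ q : ℤ, |α - 2 * (q : ℝ)| ^ 2

end Anyon

end

open MeasureTheory
open scoped ContDiff

/-! Write $E_k=\int|D_k\phi|^2$. Everything reduces to one pair: $\int|\phi|^2/|x_j-x_l|^2\le
(C_\alpha^{-1}+N-2)(E_j+E_l)$ (`lintegral_pair_le`). Each particle lies in $N-1$ pairs, so summation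
gives the theorem, even with $2(N-2)C_\alpha$ in place of $3(N-2)C_\alpha$.

For a pair, consider the closed disc with diameter $[x_j,x_l]$. If it contains no other particle,
rotate $x_j,x_l$ about their midpoint. The flux of the other particles stays outside the orbit and
can be gauged away; the pair itself leaves the constant potential $\alpha$. A half turn exchanges
the two particles, so by symmetry $\phi$ is $\pi$-periodic along the orbit. Its modes are $e^{2iqs}$
and the kinetic energy along the orbit is at least $\min_q|\alpha-2q|^2=C_\alpha/2$. With the length
of the rotation field this gives $C_\alpha^{-1}(E_j+E_l)$ (`setLIntegral_emptyDisc_le`).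

If the disc contains a particle $k$, the angle at $x_k$ is not acute, so
$|x_j-x_k|^2+|x_l-x_k|^2\le|x_j-x_l|^2$. It then suffices to bound
$\int|\phi|^2/(|x_j-x_k|^2+|x_l-x_k|^2)$. This is the Hardy inequality in the four variables
$(x_j-x_k,x_l-x_k)$, with constant $((4-2)/2)^2=1$. Its proof uses only the radial derivative, and
along rays the vector potential is pure gauge (`setLIntegral_generic_le`). There are $N-2$ choices
of $k$.

Since $\phi$ is only a distributional solution off the diagonals, neither estimate differentiates
$\phi$. For a linear flow $\Phi_s$ and a gauge $g$, the pairing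
$F(s)=\int\phi\,g\,(\psi\circ\Phi_s)$ obeys a scalar linear ODE whose source contains $D\phi$
(`GaugedFlow.hasDerivAt_pairing`). Solving it, by periodicity for rotations and from $s=-\infty$ for
dilations, bounds $|\int\phi g\psi|^2$ by $M\int W|\psi|^2$. Duality turns this into
$\int_U|\phi|^2/W\le M$ (`setLIntegral_sq_div_le_of_pairing_le`). -/

namespace Anyon

/-! ### Test functions and cutoffs -/

section Bump

variable {E : Type*} [NormedAddCommGroup E] [NormedSpace ℝ E]

/-- Smooth functions with compact support inside the set `U`. -/
structure IsBump (U : Set E) (ψ : E → ℂ) : Prop where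
  smooth : ContDiff ℝ ∞ ψ
  compact : HasCompactSupport ψ
  support : tsupport ψ ⊆ U

/-- Near a point outside `tsupport ψ` the product vanishes, so the behaviour of `g` off `U` is
irrelevant. This admits gauge phases that jump across branch cuts. -/
theorem IsBump.mul_left {U : Set E} (hU : IsOpen U) {ψ g : E → ℂ} (hψ : IsBump U ψ)
    (hg : ContDiffOn ℝ ∞ g U) : IsBump U (fun x => g x * ψ x) := by
  refine ⟨?_, hψ.compact.mul_left, (tsupport_mul_subset_right).trans hψ.support⟩
  rw [contDiff_iff_contDiffAt]
  intro x
  by_cases hx : x ∈ tsupport ψ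
  · exact ((hg x (hψ.support hx)).contDiffAt (hU.mem_nhds (hψ.support hx))).mul
      hψ.smooth.contDiffAt
  · have h0 : ψ =ᶠ[nhds x] 0 := notMem_tsupport_iff_eventuallyEq.1 hx
    refine (contDiffAt_const (c := (0 : ℂ))).congr_of_eventuallyEq ?_
    filter_upwards [h0] with y hy
    simp [hy]

theorem exists_contDiff_cutoff [FiniteDimensional ℝ E] {K U : Set E} (hK : IsCompact K)
    (hU : IsOpen U) (hKU : K ⊆ U) :
    ∃ χ : E → ℝ, ContDiff ℝ ∞ χ ∧ HasCompactSupport χ ∧ tsupport χ ⊆ U ∧ (∀ x ∈ K, χ x = 1) ∧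
      ∀ x, χ x ∈ Set.Icc 0 1 := by
  obtain ⟨K', hK', hKK', hK'U⟩ := exists_compact_between hK hU hKU
  obtain ⟨f, hf0, hf1, hf⟩ := exists_contMDiffMap_zero_one_of_isClosed (n := ⊤)
    (modelWithCornersSelf ℝ E) (s := (interior K')ᶜ) (t := K) isOpen_interior.isClosed_compl
    hK.isClosed (Set.disjoint_left.2 fun x hx hx' => hx (hKK' hx'))
  have hsupp : tsupport f ⊆ K' := by
    refine closure_minimal (fun x hx => ?_) hK'.isClosed
    by_contra hxK
    exact hx (hf0 fun h => hxK (interior_subset h))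
  exact ⟨f, f.contMDiff.contDiff, HasCompactSupport.of_support_subset_isCompact hK'
    ((subset_tsupport f).trans hsupp), hsupp.trans hK'U, fun x hx => hf1 hx, hf⟩

end Bump

/-! ### From pairing estimates to weighted square integrals -/

section Duality

variable {E : Type*} [NormedAddCommGroup E] [NormedSpace ℝ E] [FiniteDimensional ℝ E]
  [MeasurableSpace E] [BorelSpace E]

/-- A function whose pairings with smooth functions are bounded in `L²` is bounded in `L²`. -/
theorem integral_sq_le_of_pairing_le (ν : Measure E) [IsFiniteMeasureOnCompacts ν] {f : E → ℂ}
    (hf : MemLp f 2 ν) {M : ℝ} (hM : 0 ≤ M)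
    (h : ∀ ψ : E → ℂ, ContDiff ℝ ∞ ψ → HasCompactSupport ψ →
      ‖∫ x, f x * ψ x ∂ν‖ ^ 2 ≤ M * ∫ x, ‖ψ x‖ ^ 2 ∂ν) :
    ∫ x, ‖f x‖ ^ 2 ∂ν ≤ M := by
  have hf' : MemLp (fun x => (starRingEnd ℂ) (f x)) 2 ν := hf.star
  set g : Lp ℂ 2 ν := hf'.toLp with hg
  have hnorm : ∀ (u : E → ℂ) (hu : MemLp u 2 ν), ‖hu.toLp‖ ^ 2 = ∫ x, ‖u x‖ ^ 2 ∂ν := by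
    intro u hu
    rw [← @inner_self_eq_norm_sq ℂ, L2.inner_def]
    have : ∫ x, inner ℂ ((hu.toLp : Lp ℂ 2 ν) x) ((hu.toLp : Lp ℂ 2 ν) x) ∂ν =
        ((∫ x, ‖u x‖ ^ 2 ∂ν : ℝ) : ℂ) := by
      rw [← integral_complex_ofReal]
      refine integral_congr_ae ?_
      filter_upwards [hu.coeFn_toLp] with x hx
      rw [hx, inner_self_eq_norm_sq_to_K]
      norm_cast
    rw [this]; simp
  -- The bound is closed in `u` and holds on the dense class of smooth compactly supported
  -- functions. It is used below at `u = g`, the conjugate of `f`.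
  have key : ∀ u : Lp ℂ 2 ν, ‖inner ℂ g u‖ ^ 2 ≤ M * ‖u‖ ^ 2 := by
    intro u
    have hcl : IsClosed {u : Lp ℂ 2 ν | ‖inner ℂ g u‖ ^ 2 ≤ M * ‖u‖ ^ 2} :=
      isClosed_le (by fun_prop) (by fun_prop)
    have hd := Lp.dense_hasCompactSupport_contDiff (μ := ν) (F := ℂ) (p := 2) (by simp)
    have hmem := closure_minimal (t := {u : Lp ℂ 2 ν | ‖inner ℂ g u‖ ^ 2 ≤ M * ‖u‖ ^ 2}) ?_ hcl
      (hd u)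
    · exact hmem
    rintro v ⟨ψ, hvψ, hψc, hψs⟩
    have hψL : MemLp ψ 2 ν := hψs.continuous.memLp_of_hasCompactSupport hψc
    have hv : v = hψL.toLp := by
      apply Lp.ext
      exact hvψ.trans hψL.coeFn_toLp.symm
    have h1 : inner ℂ g v = ∫ x, f x * ψ x ∂ν := by
      rw [L2.inner_def]
      refine integral_congr_ae ?_
      filter_upwards [hvψ, hf'.coeFn_toLp] with x hx hx'
      rw [hx, hg, hx']
      simp [mul_comm]
    have h2 := hnorm ψ hψL
    simp only [Set.mem_ofPred_eq]
    rw [h1, hv, h2]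
    exact h ψ hψs hψc
  have h3 := hnorm _ hf'
  simp only [RCLike.norm_conj] at h3
  have h4 := key g
  rw [← h3]
  have h5 : ‖inner ℂ g g‖ = ‖g‖ ^ 2 := by
    rw [inner_self_eq_norm_sq_to_K]; simp
  rw [h5] at h4
  rcases (sq_nonneg ‖g‖).eq_or_lt with hz | hz
  · exact hz ▸ hM
  · nlinarith

/-- Duality with a weight: if `‖∫ f ψ‖² ≤ M ∫ W ‖ψ‖²` for all smooth `ψ` supported in the open
set `U`, then `∫_U ‖f‖² / W ≤ M`. -/
theorem setLIntegral_sq_div_le_of_pairing_le (μ : Measure E) [IsFiniteMeasureOnCompacts μ]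
    {U : Set E} (hU : IsOpen U) {f : E → ℂ} (hf : MemLp f 2 μ) {W : E → ℝ}
    (hW : ContDiff ℝ ∞ W) (hWpos : ∀ x ∈ U, 0 < W x) {M : ℝ} (hM : 0 ≤ M)
    (h : ∀ ψ, IsBump U ψ → ‖∫ x, f x * ψ x ∂μ‖ ^ 2 ≤ M * ∫ x, W x * ‖ψ x‖ ^ 2 ∂μ) :
    ∫⁻ x in U, ENNReal.ofReal (‖f x‖ ^ 2 / W x) ∂μ ≤ ENNReal.ofReal M := by
  have compact_case : ∀ K ⊆ U, IsCompact K →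
      ∫⁻ x in K, ENNReal.ofReal (‖f x‖ ^ 2 / W x) ∂μ ≤ ENNReal.ofReal M := by
    intro K hKU hK
    obtain ⟨χ, hχs, hχc, hχU, hχ1, hχ01⟩ := exists_contDiff_cutoff hK hU hKU
    -- With the density `p`, testing `h` against `p ψ` gives `W p² ‖ψ‖² = χ² p ‖ψ‖² ≤ p ‖ψ‖²` on the
    -- right. This is the unweighted hypothesis for the measure `p μ`, whose integral of `‖f‖²`
    -- controls that of `‖f‖² / W` on `K`.
    set p : E → ℝ := fun x => χ x ^ 2 / W x with hp
    have hχ0 : ∀ x ∉ U, χ x = 0 := fun x hx => image_eq_zero_of_notMem_tsupport fun h => hx (hχU h)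
    have hp0 : ∀ x, 0 ≤ p x := by
      intro x
      by_cases hx : x ∈ U
      · have := hWpos x hx
        positivity
      · simp [hp, hχ0 x hx]
    have hps : IsBump U (fun x => (p x : ℂ)) := by
      have hb : IsBump U (fun x => ((χ x ^ 2 : ℝ) : ℂ)) := by
        refine ⟨Complex.ofRealCLM.contDiff.comp (hχs.pow 2), ?_, ?_⟩
        · exact hχc.comp_left (g := fun t : ℝ => ((t ^ 2 : ℝ) : ℂ)) (by simp)
        · exact (tsupport_comp_subset (g := fun t : ℝ => ((t ^ 2 : ℝ) : ℂ)) (by simp) χ).trans hχU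
      have hinv : ContDiffOn ℝ ∞ (fun x => (((W x)⁻¹ : ℝ) : ℂ)) U :=
        Complex.ofRealCLM.contDiff.comp_contDiffOn
          (hW.contDiffOn.inv fun x hx => (hWpos x hx).ne')
      convert hb.mul_left hU hinv using 2 with x
      rw [hp]
      push_cast
      ring
    have hpc : Continuous p := by
      have := Complex.continuous_re.comp hps.smooth.continuous
      exact this
    have hpsupp : HasCompactSupport p := by
      have := hps.compact.comp_left (g := Complex.re) (by simp)
      exact this
    obtain ⟨B, hB⟩ := hpc.bounded_above_of_compact_support hpsupp
    set ν := μ.withDensity (fun x => ENNReal.ofReal (p x)) with hν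
    have hpm : Measurable fun x => ENNReal.ofReal (p x) := hpc.measurable.ennreal_ofReal
    have hνle : ν ≤ ENNReal.ofReal B • μ := by
      rw [hν, ← withDensity_const]
      refine withDensity_mono (Filter.Eventually.of_forall fun x => ?_)
      exact ENNReal.ofReal_le_ofReal ((le_abs_self _).trans (hB x))
    have hνfin : IsFiniteMeasureOnCompacts ν :=
      ⟨fun K hK => (hνle K).trans_lt (by
        rw [Measure.smul_apply, smul_eq_mul]
        exact ENNReal.mul_lt_top ENNReal.ofReal_lt_top hK.measure_lt_top)⟩
    have hfν : MemLp f 2 ν := hf.of_measure_le_smul ENNReal.ofReal_ne_top hνle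
    have hint : ∀ (F : Type) [NormedAddCommGroup F] [NormedSpace ℝ F] (u : E → F),
        ∫ x, u x ∂ν = ∫ x, p x • u x ∂μ := by
      intro F _ _ u
      rw [hν, integral_withDensity_eq_integral_toReal_smul hpm
        (Filter.Eventually.of_forall fun x => ENNReal.ofReal_lt_top)]
      simp only [ENNReal.toReal_ofReal (hp0 _)]
    have hmain : ∫ x, ‖f x‖ ^ 2 ∂ν ≤ M := by
      refine integral_sq_le_of_pairing_le ν hfν hM fun ψ hψs hψc => ?_
      have hb := hps.mul_left hU hψs.contDiffOn
      have h1 := h _ hb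
      rw [hint, hint]
      have e1 : ∫ x, p x • (f x * ψ x) ∂μ = ∫ x, f x * (ψ x * (p x : ℂ)) ∂μ := by
        congr 1; ext x; rw [Complex.real_smul]; ring
      rw [e1]
      refine h1.trans ?_
      gcongr ?_ * ?_
      refine integral_mono ?_ ?_ fun x => ?_
      · refine Continuous.integrable_of_hasCompactSupport ?_ ?_
        · have := hb.smooth.continuous
          have := hW.continuous
          fun_prop
        · have := (hb.compact.comp_left (g := fun t : ℂ => ‖t‖ ^ 2) (by simp)).mul_left (f := W)
          exact this
      · refine Continuous.integrable_of_hasCompactSupport ?_ ?_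
        · have := hψs.continuous
          fun_prop
        · exact hpsupp.smul_right
      · simp only [norm_mul, Complex.norm_real, Real.norm_eq_abs, mul_pow, sq_abs, smul_eq_mul]
        by_cases hx : x ∈ U
        · have hw := hWpos x hx
          have h2 : W x * p x = χ x ^ 2 := by simp only [hp]; field_simp
          have h3 : χ x ^ 2 ≤ 1 := pow_le_one₀ (hχ01 x).1 (hχ01 x).2
          calc W x * (‖ψ x‖ ^ 2 * p x ^ 2) = (W x * p x) * (p x * ‖ψ x‖ ^ 2) := by ring
            _ ≤ 1 * (p x * ‖ψ x‖ ^ 2) := by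
                rw [h2]
                exact mul_le_mul_of_nonneg_right h3 (mul_nonneg (hp0 x) (by positivity))
            _ = _ := one_mul _
        · simp [hp, hχ0 x hx]
    have hL : ∫⁻ x, ENNReal.ofReal (‖f x‖ ^ 2) ∂ν ≤ ENNReal.ofReal M := by
      rw [← ofReal_integral_eq_lintegral_ofReal ((memLp_two_iff_integrable_sq_norm hfν.1).1 hfν)]
      · exact ENNReal.ofReal_le_ofReal hmain
      · exact Filter.Eventually.of_forall fun x => by positivity
    rw [hν, lintegral_withDensity_eq_lintegral_mul_non_measurable _ hpm
      (Filter.Eventually.of_forall fun x => ENNReal.ofReal_lt_top)] at hL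
    refine le_trans ?_ hL
    rw [← lintegral_indicator hK.measurableSet]
    refine lintegral_mono fun x => ?_
    by_cases hx : x ∈ K
    · simp only [Set.indicator_of_mem hx, Pi.mul_apply]
      rw [← ENNReal.ofReal_mul (hp0 x)]
      refine ENNReal.ofReal_le_ofReal (le_of_eq ?_)
      simp only [hp, hχ1 x hx]; ring
    · simp [Set.indicator_of_notMem hx]
  -- The bound is uniform in `K`, so an increasing exhaustion of `U` by compact sets finishes.
  obtain ⟨F, hFc, hFU, hFunion, hFmono⟩ := hU.exists_iUnion_isClosed
  have hK : ∀ n, IsCompact (F n ∩ Metric.closedBall 0 n) := fun n =>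
    (isCompact_closedBall (0 : E) (n : ℝ)).inter_left (hFc n)
  have hmono : Monotone fun n : ℕ => F n ∩ Metric.closedBall (0 : E) n := fun m n hmn =>
    Set.inter_subset_inter (hFmono hmn) (Metric.closedBall_subset_closedBall (by exact_mod_cast hmn))
  have hun : U = ⋃ n : ℕ, F n ∩ Metric.closedBall (0 : E) n := by
    refine subset_antisymm (fun x hx => ?_) (Set.iUnion_subset fun n => Set.inter_subset_left.trans
      (hFU n))
    rw [← hFunion] at hx
    obtain ⟨n, hn⟩ := Set.mem_iUnion.1 hx
    obtain ⟨m, hm⟩ := exists_nat_ge ‖x‖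
    refine Set.mem_iUnion.2 ⟨max n m, hFmono (le_max_left n m) hn, ?_⟩
    rw [mem_closedBall_zero_iff]
    exact hm.trans (by exact_mod_cast le_max_right n m)
  rw [hun, setLIntegral_iUnion_of_directed _ hmono.directed_le]
  exact iSup_le fun n => compact_case _ (Set.inter_subset_left.trans (hFU n)) (hK n)

end Duality

/-! ### One-dimensional estimates on the circle of length π -/

/-- A magnetic Poincaré inequality on the circle of length `π`. -/
theorem mul_integral_sq_le_integral_deriv_sub {α m : ℝ} (hm : ∀ q : ℤ, m ≤ |α - 2 * q| ^ 2)
    {y y' : ℝ → ℂ} (hy : ∀ t, HasDerivAt y (y' t) t) (hy' : Continuous y')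
    (hper : y Real.pi = y 0) :
    m * ∫ t in (0 : ℝ)..Real.pi, ‖y t‖ ^ 2 ≤
      ∫ t in (0 : ℝ)..Real.pi, ‖y' t - Complex.I * α * y t‖ ^ 2 := by
  have hyc : Continuous y := continuous_iff_continuousAt.2 fun t => (hy t).continuousAt
  have hmem : ∀ u : ℝ → ℂ, Continuous u → MemLp u 2 (volume.restrict (Set.Ioc 0 Real.pi)) := by
    intro u hu
    refine MemLp.mono_measure (Measure.restrict_mono Set.Ioc_subset_Icc_self le_rfl) ?_
    rw [memLp_two_iff_integrable_sq_norm hu.aestronglyMeasurable]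
    exact (by fun_prop : Continuous fun x => ‖u x‖ ^ 2).continuousOn.integrableOn_compact
      isCompact_Icc
  have hpi := Real.pi_pos
  have h1 := hasSum_sq_fourierCoeffOn hpi (hmem y hyc)
  have h2 := hasSum_sq_fourierCoeffOn hpi (hmem (fun t => y' t - Complex.I * α * y t)
    (by fun_prop))
  have hlin : ∀ q : ℤ, fourierCoeffOn hpi (fun t => y' t - Complex.I * α * y t) q =
      fourierCoeffOn hpi y' q - Complex.I * α * fourierCoeffOn hpi y q := by
    intro q
    have hF : Continuous fun x : ℝ => fourier (-q) (x : AddCircle (Real.pi - 0)) :=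
      (map_continuous (fourier (-q))).comp (AddCircle.continuous_mk' _)
    simp only [fourierCoeffOn_eq_integral, smul_eq_mul, Complex.real_smul]
    have : ∀ x : ℝ, fourier (-q) (x : AddCircle (Real.pi - 0)) * (y' x - Complex.I * α * y x) =
        fourier (-q) (x : AddCircle (Real.pi - 0)) * y' x -
        Complex.I * α * (fourier (-q) (x : AddCircle (Real.pi - 0)) * y x) := fun x => by ring
    simp_rw [this]
    rw [intervalIntegral.integral_sub, intervalIntegral.integral_const_mul]
    · ring
    · exact (hF.mul hy').intervalIntegrable _ _
    · exact (continuous_const.mul (hF.mul hyc)).intervalIntegrable _ _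
  -- The modes on an interval of length `π` are `exp (2 i q t)`, and `y π = y 0` removes the
  -- boundary term. Hence `y' - iαy` has coefficients `-i (α - 2q)` times those of `y`, and Parseval
  -- concludes.
  have hder : ∀ q : ℤ, fourierCoeffOn hpi y' q = 2 * Complex.I * q * fourierCoeffOn hpi y q := by
    intro q
    by_cases hq : q = 0
    · subst hq
      rw [fourierCoeffOn_eq_integral]
      simp [intervalIntegral.integral_eq_sub_of_hasDerivAt (fun t _ => hy t)
        (hy'.intervalIntegrable 0 Real.pi), hper]
    · rw [fourierCoeffOn_of_hasDerivAt hpi hq (fun x _ => hy x) (hy'.intervalIntegrable _ _), hper]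
      have : (q : ℂ) ≠ 0 := by exact_mod_cast hq
      have : (Real.pi : ℂ) ≠ 0 := by exact_mod_cast hpi.ne'
      field_simp
      simp
  have hle : ∀ q : ℤ, m * ‖fourierCoeffOn hpi y q‖ ^ 2 ≤
      ‖fourierCoeffOn hpi (fun t => y' t - Complex.I * α * y t) q‖ ^ 2 := by
    intro q
    rw [hlin, hder]
    have : 2 * Complex.I * q * fourierCoeffOn hpi y q - Complex.I * α * fourierCoeffOn hpi y q =
        -Complex.I * ((α - 2 * q : ℝ) : ℂ) * fourierCoeffOn hpi y q := by push_cast; ring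
    rw [this, norm_mul, norm_mul, norm_neg, Complex.norm_I, one_mul, Complex.norm_real, mul_pow,
      Real.norm_eq_abs]
    exact mul_le_mul_of_nonneg_right (hm q) (by positivity)
  have h3 := hasSum_le hle (h1.mul_left m) h2
  simp only [sub_zero, smul_eq_mul] at h3
  have h4 : Real.pi⁻¹ * (m * ∫ t in (0 : ℝ)..Real.pi, ‖y t‖ ^ 2) ≤
      Real.pi⁻¹ * ∫ t in (0 : ℝ)..Real.pi, ‖y' t - Complex.I * α * y t‖ ^ 2 := by
    linarith
  exact le_of_mul_le_mul_left h4 (by positivity)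

/-- The `L²` bound for the solution operator of `y' - iαy = -i(e^{-iαπ} - 1) h` on `π`-periodic
functions. -/
theorem mul_integral_sq_average_le {α m : ℝ} (hm : ∀ q : ℤ, m ≤ |α - 2 * q| ^ 2) {h : ℝ → ℂ}
    (hc : Continuous h) (hper : ∀ t, h (t + Real.pi) = h t) :
    m * ∫ t in (0 : ℝ)..Real.pi,
        ‖∫ s in (0 : ℝ)..Real.pi, Complex.exp (-(Complex.I * α * s)) * h (s + t)‖ ^ 2 ≤
      ‖Complex.exp (-(Complex.I * α * Real.pi)) - 1‖ ^ 2 * ∫ t in (0 : ℝ)..Real.pi, ‖h t‖ ^ 2 := by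
  set e : ℝ → ℂ := fun s => Complex.exp (-(Complex.I * α * s)) with he
  set y : ℝ → ℂ := fun t => ∫ s in (0 : ℝ)..Real.pi, e s * h (s + t) with hy
  have hec : Continuous e := by fun_prop
  -- After the shift, `t` occurs only in the prefactor and in the limits of integration, so `y` is
  -- differentiable although `h` is merely continuous.
  have hy_eq : ∀ t, y t = Complex.exp (Complex.I * α * t) *
      ((∫ s in (0 : ℝ)..(t + Real.pi), e s * h s) - ∫ s in (0 : ℝ)..t, e s * h s) := by
    intro t
    have hI : ∀ a b : ℝ, IntervalIntegrable (fun s => e s * h s) volume a b := fun a b =>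
      (hec.mul hc).intervalIntegrable a b
    rw [intervalIntegral.integral_interval_sub_left (hI _ _) (hI _ _),
      ← intervalIntegral.integral_const_mul]
    have := intervalIntegral.integral_comp_add_right (a := 0) (b := Real.pi)
      (fun s => Complex.exp (Complex.I * α * t) * (e s * h s)) t
    rw [zero_add, add_comm Real.pi t] at this
    rw [← this, hy]
    refine intervalIntegral.integral_congr fun s _ => ?_
    simp only [he]
    rw [← mul_assoc, ← Complex.exp_add]
    congr 2
    push_cast
    ring
  have hyd : ∀ t, HasDerivAt y (Complex.I * α * y t +
      (Complex.exp (-(Complex.I * α * Real.pi)) - 1) * h t) t := by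
    intro t
    have d1 : HasDerivAt (fun t : ℝ => ∫ s in (0 : ℝ)..t, e s * h s) (e t * h t) t :=
      (hec.mul hc).integral_hasStrictDerivAt 0 t |>.hasDerivAt
    have d2 : HasDerivAt (fun t : ℝ => ∫ s in (0 : ℝ)..(t + Real.pi), e s * h s)
        (e (t + Real.pi) * h (t + Real.pi)) t :=
      (((hec.mul hc).integral_hasStrictDerivAt 0 (t + Real.pi)).hasDerivAt).comp_add_const t Real.pi
    have d3 : HasDerivAt (fun t : ℝ => Complex.exp (Complex.I * α * t))
        (Complex.exp (Complex.I * α * t) * (Complex.I * α)) t := by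
      have := ((hasDerivAt_id t).ofReal_comp.const_mul (Complex.I * (α : ℂ))).cexp
      simpa using this
    have d4 := d3.mul (d2.sub d1)
    have hfun : y = fun t : ℝ => Complex.exp (Complex.I * α * t) *
      ((∫ s in (0 : ℝ)..(t + Real.pi), e s * h s) - ∫ s in (0 : ℝ)..t, e s * h s) := funext hy_eq
    rw [hfun]
    refine d4.congr_deriv ?_
    have e1 : Complex.exp (Complex.I * α * t) * e t = 1 := by
      rw [he, ← Complex.exp_add]; simp
    have e2 : Complex.exp (Complex.I * α * t) * e (t + Real.pi) =
        Complex.exp (-(Complex.I * α * Real.pi)) := by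
      rw [he, ← Complex.exp_add]; congr 1; push_cast; ring
    simp only [Pi.sub_apply]
    rw [hper t]
    linear_combination h t * e2 - h t * e1
  have hyc : Continuous y := continuous_iff_continuousAt.2 fun t => (hyd t).continuousAt
  have hyper : y Real.pi = y 0 := by
    simp only [hy, hper, add_zero]
  have := mul_integral_sq_le_integral_deriv_sub hm hyd (by fun_prop) hyper
  refine this.trans (le_of_eq ?_)
  rw [← intervalIntegral.integral_const_mul]
  refine intervalIntegral.integral_congr fun t _ => ?_
  simp only [add_sub_cancel_left, norm_mul, mul_pow]

/-! ### Linear flows and differentiation of pairings along them -/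

section Flow

variable {E : Type*} [NormedAddCommGroup E] [NormedSpace ℝ E]

/-- A one-parameter group of linear maps with its generator. -/
structure LinearFlow (E : Type*) [NormedAddCommGroup E] [NormedSpace ℝ E] where
  /-- The maps of the group. -/
  flow : ℝ → E →L[ℝ] E
  /-- The generator of the group. -/
  gen : E →L[ℝ] E
  flow_zero : ∀ x, flow 0 x = x
  flow_add : ∀ s t x, flow (s + t) x = flow s (flow t x)
  hasDerivAt_flow : ∀ s x, HasDerivAt (fun s => flow s x) (gen (flow s x)) s
  continuous_flow : Continuous fun p : ℝ × E => flow p.1 p.2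

namespace LinearFlow

variable (Φ : LinearFlow E)

theorem flow_neg_flow (s : ℝ) (x : E) : Φ.flow (-s) (Φ.flow s x) = x := by
  rw [← Φ.flow_add, neg_add_cancel, Φ.flow_zero]

theorem flow_flow_neg (s : ℝ) (x : E) : Φ.flow s (Φ.flow (-s) x) = x := by
  rw [← Φ.flow_add, add_neg_cancel, Φ.flow_zero]

/-- The maps of a linear flow as homeomorphisms. -/
def homeo (s : ℝ) : E ≃ₜ E where
  toFun := Φ.flow s
  invFun := Φ.flow (-s)
  left_inv := Φ.flow_neg_flow s
  right_inv := Φ.flow_flow_neg s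
  continuous_toFun := (Φ.flow s).continuous
  continuous_invFun := (Φ.flow (-s)).continuous

theorem gen_flow (s : ℝ) (x : E) : Φ.gen (Φ.flow s x) = Φ.flow s (Φ.gen x) := by
  have h1 : HasDerivAt (fun t => Φ.flow (s + t) x) (Φ.gen (Φ.flow s x)) 0 := by
    have := Φ.hasDerivAt_flow (s + 0) x
    simpa using HasDerivAt.comp_const_add s 0 this
  have h2 : HasDerivAt (fun t => Φ.flow (s + t) x) (Φ.flow s (Φ.gen x)) 0 := by
    have h3 := Φ.hasDerivAt_flow 0 x
    rw [Φ.flow_zero] at h3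
    simp only [Φ.flow_add]
    exact (Φ.flow s).hasFDerivAt.comp_hasDerivAt (0 : ℝ) h3
  exact h1.unique h2

/-- The flow commutes with its generator. Thus the derivative in `s` of `ψ ∘ Φ.flow s` is also a
derivative in `x` along the vector field, to which the distributional equation applies at every
time. -/
theorem fderiv_comp_flow {ψ : E → ℂ} (hψ : ContDiff ℝ ∞ ψ) (s : ℝ) (x : E) :
    fderiv ℝ (fun y => ψ (Φ.flow s y)) x (Φ.gen x) =
      fderiv ℝ ψ (Φ.flow s x) (Φ.gen (Φ.flow s x)) := by
  have h := ((hψ.differentiable (by simp)) (Φ.flow s x)).hasFDerivAt.comp x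
    (Φ.flow s).hasFDerivAt
  have h' : fderiv ℝ (fun y => ψ (Φ.flow s y)) x = (fderiv ℝ ψ (Φ.flow s x)).comp (Φ.flow s) :=
    h.fderiv
  rw [h', Φ.gen_flow]
  rfl

theorem isBump_comp_flow {U : Set E} (hinv : ∀ s, ∀ x ∈ U, Φ.flow s x ∈ U) {ψ : E → ℂ}
    (hψ : IsBump U ψ) (s : ℝ) : IsBump U (fun x => ψ (Φ.flow s x)) := by
  refine ⟨hψ.smooth.comp (Φ.flow s).contDiff, hψ.compact.comp_homeomorph (Φ.homeo s), ?_⟩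
  have h1 : tsupport (fun x => ψ (Φ.flow s x)) ⊆ Φ.flow s ⁻¹' tsupport ψ :=
    closure_minimal (fun x hx => subset_tsupport ψ hx)
      ((isClosed_tsupport ψ).preimage (Φ.flow s).continuous)
  intro x hx
  have := hinv (-s) _ (hψ.support (h1 hx))
  rwa [Φ.flow_neg_flow] at this

theorem isCompact_orbit {K : Set E} (hK : IsCompact K) (a b : ℝ) :
    IsCompact ((fun p : ℝ × E => Φ.flow p.1 p.2) '' (Set.Icc a b ×ˢ K)) :=
  (isCompact_Icc.prod hK).image Φ.continuous_flow

variable [MeasurableSpace E] [BorelSpace E]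

/-- The flow `Φ` changes the measure `μ` at the exponential rate `δ`. -/
def HasDivergence (μ : Measure E) (δ : ℝ) : Prop :=
  ∀ s, Measure.map (Φ.flow s) μ = ENNReal.ofReal (Real.exp (-(δ * s))) • μ

variable {Φ}

theorem HasDivergence.integral_comp {μ : Measure E} {δ : ℝ} (h : Φ.HasDivergence μ δ)
    {F : Type*} [NormedAddCommGroup F] [NormedSpace ℝ F] (u : E → F) (s : ℝ) :
    ∫ x, u (Φ.flow s x) ∂μ = Real.exp (-(δ * s)) • ∫ x, u x ∂μ := by
  have := (Φ.homeo s).measurableEmbedding.integral_map (μ := μ) u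
  rw [show ⇑(Φ.homeo s) = Φ.flow s from rfl, h s, integral_smul_measure,
    ENNReal.toReal_ofReal (Real.exp_pos _).le] at this
  exact this.symm

variable (Φ)

/-- The derivative falls on `ψ`, so local integrability of `f` is enough: for times near `s` all
integrands are supported in one compact set `K` swept out by the flow, which provides the dominating
function. -/
theorem hasDerivAt_integral_mul_comp_flow [FiniteDimensional ℝ E] {μ : Measure E} {f : E → ℂ}
    (hf : LocallyIntegrable f μ)
    {ψ : E → ℂ} (hψ : ContDiff ℝ ∞ ψ) (hψc : HasCompactSupport ψ) (s : ℝ) :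
    HasDerivAt (fun s => ∫ x, f x * ψ (Φ.flow s x) ∂μ)
      (∫ x, f x * fderiv ℝ ψ (Φ.flow s x) (Φ.gen (Φ.flow s x)) ∂μ) s := by
  set K := (fun p : ℝ × E => Φ.flow p.1 p.2) '' (Set.Icc (-(s + 1)) (-(s - 1)) ×ˢ tsupport ψ)
    with hK
  have hKc : IsCompact K := Φ.isCompact_orbit hψc _ _
  have hmem : ∀ t ∈ Set.Ioo (s - 1) (s + 1), ∀ x, Φ.flow t x ∈ tsupport ψ → x ∈ K := by
    intro t ht x hx
    exact ⟨(-t, Φ.flow t x), ⟨⟨by linarith [ht.2], by linarith [ht.1]⟩, hx⟩, Φ.flow_neg_flow t x⟩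
  set u : E → ℂ := fun y => fderiv ℝ ψ y (Φ.gen y) with hu
  have huc : Continuous u := by
    have := hψ.continuous_fderiv (by simp)
    fun_prop
  have husupp : ∀ y, y ∉ tsupport ψ → u y = 0 := by
    intro y hy
    simp only [hu]
    rw [image_eq_zero_of_notMem_tsupport fun h => hy (tsupport_fderiv_subset ℝ h)]
    simp
  have hucomp : HasCompactSupport u := by
    refine HasCompactSupport.of_support_subset_isCompact hψc fun y hy => ?_
    by_contra h
    exact hy (husupp y h)
  obtain ⟨C, hC⟩ := huc.bounded_above_of_compact_support hucomp
  have hmeas : ∀ v : E → ℂ, Continuous v → ∀ t, AEStronglyMeasurable (fun x => f x * v (Φ.flow t x))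
      μ := fun v hv t =>
    hf.aestronglyMeasurable.mul (hv.comp (Φ.flow t).continuous).aestronglyMeasurable
  have hball : Set.Ioo (s - 1) (s + 1) ∈ nhds s := Ioo_mem_nhds (by linarith) (by linarith)
  have hbound : Integrable (K.indicator fun x => ‖f x‖ * C) μ :=
    (integrable_indicator_iff hKc.measurableSet).2 ((hf.integrableOn_isCompact hKc).norm.mul_const C)
  refine (hasDerivAt_integral_of_dominated_loc_of_deriv_le (𝕜 := ℝ) (μ := μ) (x₀ := s)
    (F := fun t x => f x * ψ (Φ.flow t x)) (F' := fun t x => f x * u (Φ.flow t x))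
    (bound := K.indicator fun x => ‖f x‖ * C) hball
    (Filter.Eventually.of_forall fun t => hmeas ψ hψ.continuous t) ?_ (hmeas u huc s) ?_ hbound
    ?_).2
  · obtain ⟨C', hC'⟩ := hψ.continuous.bounded_above_of_compact_support hψc
    have hb' : Integrable (K.indicator fun x => ‖f x‖ * C') μ :=
      (integrable_indicator_iff hKc.measurableSet).2
        ((hf.integrableOn_isCompact hKc).norm.mul_const C')
    refine hb'.mono' (hmeas ψ hψ.continuous s) (Filter.Eventually.of_forall fun x => ?_)
    by_cases hx : x ∈ K
    · rw [Set.indicator_of_mem hx, norm_mul]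
      exact mul_le_mul_of_nonneg_left (hC' _) (norm_nonneg _)
    · rw [image_eq_zero_of_notMem_tsupport fun h => hx (hmem s ⟨by linarith, by linarith⟩ x h)]
      simp [Set.indicator_of_notMem hx]
  · refine Filter.Eventually.of_forall fun x t ht => ?_
    by_cases hx : x ∈ K
    · rw [Set.indicator_of_mem hx, norm_mul]
      exact mul_le_mul_of_nonneg_left (hC _) (norm_nonneg _)
    · rw [husupp _ fun h => hx (hmem t ht x h)]
      simp [Set.indicator_of_notMem hx]
  · refine Filter.Eventually.of_forall fun x t _ => ?_
    exact ((((hψ.differentiable (by simp)) (Φ.flow t x)).hasFDerivAt).comp_hasDerivAt t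
      (Φ.hasDerivAt_flow t x)).const_mul (f x)

end LinearFlow

end Flow

/-! ### The distributional magnetic derivative along a linear vector field -/

section Identity

variable {N : ℕ}

theorem isOpen_compl_diagonals : IsOpen (diagonals N)ᶜ := by
  have : (diagonals N)ᶜ = ⋂ j : Fin N, ⋂ l : Fin N, {x | j ≠ l → x j ≠ x l} := by
    ext x; simp [diagonals]
  rw [this]
  refine isOpen_iInter_of_finite fun j => isOpen_iInter_of_finite fun l => ?_
  by_cases h : j = l
  · simp [h]
  · simp only [ne_eq, h, not_false_eq_true, forall_const]
    exact isOpen_ne_fun (continuous_apply j) (continuous_apply l)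

theorem contDiffOn_vectorPotential (j : Fin N) (a : Fin 2) :
    ContDiffOn ℝ ∞ (fun x => vectorPotential j x a) (diagonals N)ᶜ := by
  simp only [vectorPotential, WithLp.ofLp_sum, Finset.sum_apply, PiLp.smul_apply, smul_eq_mul]
  refine ContDiffOn.sum fun k hk => ?_
  have hd : ContDiff ℝ ∞ fun x : Config N => x j - x k := by fun_prop
  refine ContDiffOn.mul (ContDiffOn.inv (hd.norm_sq ℝ).contDiffOn fun x hx => ?_) ?_
  · have : x j ≠ x k := fun h => hx ⟨j, k, (Finset.ne_of_mem_erase hk).symm, h⟩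
    simpa [sub_eq_zero] using this
  · fin_cases a
    · simp only [perp]
      exact ((EuclideanSpace.proj (𝕜 := ℝ) (1 : Fin 2)).contDiff.comp hd).neg.contDiffOn
    · simp only [perp]
      exact ((EuclideanSpace.proj (𝕜 := ℝ) (0 : Fin 2)).contDiff.comp hd).contDiffOn

theorem integrable_mul_bump {E : Type*} [NormedAddCommGroup E] [NormedSpace ℝ E]
    [FiniteDimensional ℝ E] [MeasurableSpace E] [BorelSpace E] {μ : Measure E}
    [IsFiniteMeasureOnCompacts μ] {f ψ : E → ℂ} (hf : MemLp f 2 μ) {U : Set E}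
    (hψ : IsBump U ψ) : Integrable (fun x => f x * ψ x) μ :=
  MemLp.integrable_mul (p := 2) (q := 2) hf
    (hψ.smooth.continuous.memLp_of_hasCompactSupport hψ.compact)

theorem sum_smul_single (v : Config N) :
    ∑ i, ∑ a, (v i a) • (Pi.single i (EuclideanSpace.single a (1 : ℝ)) : Config N) = v := by
  funext i
  ext a
  simp only [Finset.sum_apply, Pi.smul_apply, WithLp.ofLp_sum]
  rw [Finset.sum_eq_single i]
  · rw [Finset.sum_eq_single a]
    · simp
    · intro b _ hb
      simp [hb.symm]
    · simp
  · intro k _ hk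
    simp [Pi.single_eq_of_ne hk.symm]
  · simp

theorem sum_sum_integral {X : Type*} [MeasurableSpace X] {μ : Measure X} {f : Fin N → Fin 2 → X → ℂ}
    (hf : ∀ i a, Integrable (f i a) μ) :
    ∑ i, ∑ a, ∫ x, f i a x ∂μ = ∫ x, ∑ i, ∑ a, f i a x ∂μ := by
  rw [integral_finsetSum _ fun i _ => integrable_finsetSum _ fun a _ => hf i a]
  exact Finset.sum_congr rfl fun i _ => (integral_finsetSum _ fun a _ => hf i a).symm

/-- The component `∑ V_i · D_i φ` of the magnetic derivative along a linear vector field. -/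
noncomputable def derivAlong (V : Config N →L[ℝ] Config N)
    (G : Fin N → Config N → EuclideanSpace ℂ (Fin 2))
    (x : Config N) : ℂ :=
  ∑ i, ∑ a, G i x a * (V x i a : ℂ)

/-- The component `∑ V_i · A_i` of the vector potential along a linear vector field. -/
noncomputable def potentialAlong (V : Config N →L[ℝ] Config N) (x : Config N) : ℝ :=
  ∑ i, ∑ a, vectorPotential i x a * V x i a

/-- The divergence of a linear vector field. -/
noncomputable def divergence (V : Config N →L[ℝ] Config N) : ℝ :=
  ∑ i, ∑ a, V (Pi.single i (EuclideanSpace.single a 1)) i a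

/-- The distributional magnetic derivative along a linear vector field, after a change of gauge. -/
theorem integral_derivAlong_mul {α : ℝ} {φ : Config N → ℂ} (hφ : MemLp φ 2 volume)
    {G : Fin N → Config N → EuclideanSpace ℂ (Fin 2)} (hG : ∀ j, MemLp (G j) 2 volume)
    (hD : ∀ j, IsMagneticDeriv α j φ (G j)) (V : Config N →L[ℝ] Config N) {U : Set (Config N)}
    (hU : IsOpen U) (hUd : U ⊆ (diagonals N)ᶜ) {g : Config N → ℂ} (hg : ContDiffOn ℝ ∞ g U) {c : ℂ}
    (hgauge : ∀ x ∈ U, Complex.I * fderiv ℝ g x (V x) + (α * potentialAlong V x : ℝ) * g x =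
      c * g x) {ψ : Config N → ℂ} (hψ : IsBump U ψ) :
    ∫ x, derivAlong V G x * (g x * ψ x) =
      ∫ x, φ x * (g x * (Complex.I * fderiv ℝ ψ x (V x) +
        (Complex.I * divergence V + c) * ψ x)) := by
  set χ : Config N → ℂ := fun x => g x * ψ x with hχ
  have hχb : IsBump U χ := hψ.mul_left hU hg
  have hχd : Differentiable ℝ χ := hχb.smooth.differentiable (by simp)
  have hVs : ∀ i a, ContDiff ℝ ∞ fun x : Config N => ((V x i a : ℝ) : ℂ) := fun i a =>
    (Complex.ofRealCLM.comp ((EuclideanSpace.proj (𝕜 := ℝ) a).comp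
      ((ContinuousLinearMap.proj i).comp V))).contDiff
  have hb : ∀ i a, IsBump U fun x => ((V x i a : ℝ) : ℂ) * χ x := fun i a =>
    hχb.mul_left hU (hVs i a).contDiffOn
  -- The equation for `D_i` is tested with the `(i, a)` component of the field `χ V`. Summation
  -- produces the derivative of `χ` along `V`, and differentiating the coefficients of `V` produces
  -- the divergence.
  have htest : ∀ i a, IsTestFunction fun x => ((V x i a : ℝ) : ℂ) * χ x := fun i a =>
    ⟨(hb i a).smooth, (hb i a).compact, (hb i a).support.trans hUd⟩
  have hGa : ∀ i a, MemLp (fun x => G i x a) 2 volume := fun i a =>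
    (EuclideanSpace.proj (𝕜 := ℂ) a).comp_memLp' (hG i)
  have hpd : ∀ i a x, partialDeriv i a (fun x => ((V x i a : ℝ) : ℂ) * χ x) x =
      (V (Pi.single i (EuclideanSpace.single a 1)) i a : ℂ) * χ x +
        (V x i a : ℂ) * fderiv ℝ χ x (Pi.single i (EuclideanSpace.single a 1)) := by
    intro i a x
    set T : Config N →L[ℝ] ℂ := Complex.ofRealCLM.comp ((EuclideanSpace.proj (𝕜 := ℝ) a).comp
      ((ContinuousLinearMap.proj i).comp V)) with hT
    have h := (T.hasFDerivAt (x := x)).mul (hχd x).hasFDerivAt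
    have h' : fderiv ℝ (fun x => ((V x i a : ℝ) : ℂ) * χ x) x = _ := h.fderiv
    rw [partialDeriv, h']
    simp [hT]
    ring
  have hint : ∀ i a, Integrable fun x => φ x * (Complex.I *
      partialDeriv i a (fun x => ((V x i a : ℝ) : ℂ) * χ x) x +
      ((α * vectorPotential i x a : ℝ) : ℂ) * (((V x i a : ℝ) : ℂ) * χ x)) := by
    intro i a
    have hA : IsBump U fun x => ((α * vectorPotential i x a : ℝ) : ℂ) *
        (((V x i a : ℝ) : ℂ) * χ x) := (hb i a).mul_left hU
      (Complex.ofRealCLM.contDiff.comp_contDiffOn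
        (contDiffOn_const.mul ((contDiffOn_vectorPotential i a).mono hUd)))
    have hP : IsBump U fun x => Complex.I *
        partialDeriv i a (fun x => ((V x i a : ℝ) : ℂ) * χ x) x := by
      refine IsBump.mul_left hU ⟨?_, ?_, ?_⟩ contDiffOn_const
      · exact ((hb i a).smooth.fderiv_right (m := ∞) (by simp)).clm_apply contDiff_const
      · exact (hb i a).compact.fderiv_apply (𝕜 := ℝ) _
      · exact (tsupport_fderiv_apply_subset ℝ _).trans (hb i a).support
    simp only [mul_add]
    simpa only [mul_add] using! (integrable_mul_bump hφ hP).add (integrable_mul_bump hφ hA)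
  have e1 : ∫ x, derivAlong V G x * χ x =
      ∑ i, ∑ a, ∫ x, G i x a * (((V x i a : ℝ) : ℂ) * χ x) := by
    rw [sum_sum_integral fun i a => integrable_mul_bump (hGa i a) (hb i a)]
    refine integral_congr_ae (Filter.Eventually.of_forall fun x => ?_)
    simp only [derivAlong, Finset.sum_mul]
    exact Finset.sum_congr rfl fun i _ => Finset.sum_congr rfl fun a _ => by ring
  rw [e1]
  simp_rw [fun i a => hD i _ (htest i a) a]
  rw [sum_sum_integral hint]
  refine integral_congr_ae (Filter.Eventually.of_forall fun x => ?_)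
  simp only [hpd, ← Finset.mul_sum]
  congr 1
  have hsum : ∑ i, ∑ a, (V x i a : ℂ) * fderiv ℝ χ x (Pi.single i (EuclideanSpace.single a 1)) =
      fderiv ℝ χ x (V x) := by
    conv_rhs => rw [← sum_smul_single (V x)]
    simp only [map_sum, map_smul, Complex.real_smul]
  have hexp : ∑ i, ∑ a, (Complex.I * ((V (Pi.single i (EuclideanSpace.single a 1)) i a : ℂ) * χ x +
        (V x i a : ℂ) * fderiv ℝ χ x (Pi.single i (EuclideanSpace.single a 1))) +
        ((α * vectorPotential i x a : ℝ) : ℂ) * ((V x i a : ℂ) * χ x)) =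
      Complex.I * (divergence V * χ x + fderiv ℝ χ x (V x)) +
        (α * potentialAlong V x : ℝ) * χ x := by
    rw [← hsum]
    simp only [divergence, potentialAlong]
    push_cast
    simp only [Finset.mul_sum, Finset.sum_mul, ← Finset.sum_add_distrib]
    exact Finset.sum_congr rfl fun i _ => Finset.sum_congr rfl fun a _ => by ring
  rw [hexp]
  -- The gauge relation is known on `U` only. Off `tsupport ψ` both sides vanish, whatever `g` is
  -- there.
  by_cases hx : x ∈ tsupport ψ
  · have hxU := hψ.support hx
    have hgd : DifferentiableAt ℝ g x :=
      ((hg x hxU).contDiffAt (hU.mem_nhds hxU)).differentiableAt (by simp)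
    have hψd : DifferentiableAt ℝ ψ x := hψ.smooth.differentiable (by simp) x
    have h1 : fderiv ℝ χ x (V x) = g x * fderiv ℝ ψ x (V x) + ψ x * fderiv ℝ g x (V x) := by
      have h2 : fderiv ℝ χ x = _ := (hgd.hasFDerivAt.mul hψd.hasFDerivAt).fderiv
      rw [h2]
      simp
    rw [h1]
    simp only [hχ]
    linear_combination ψ x * hgauge x hxU
  · have h1 : ψ x = 0 := image_eq_zero_of_notMem_tsupport hx
    have h2 : fderiv ℝ ψ x = 0 :=
      image_eq_zero_of_notMem_tsupport fun h => hx (tsupport_fderiv_subset ℝ h)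
    have h3 : fderiv ℝ χ x = 0 := image_eq_zero_of_notMem_tsupport fun h =>
      hx (tsupport_mul_subset_right (tsupport_fderiv_subset ℝ h))
    have h4 : χ x = 0 := by simp [hχ, h1]
    rw [h1, h2, h3, h4]
    simp

end Identity

/-! ### Change of volume under a linear flow -/

section Divergence

variable {N : ℕ}

theorem integral_fderiv_apply_gen (V : Config N →L[ℝ] Config N) {ψ : Config N → ℂ}
    (hψ : ContDiff ℝ ∞ ψ) (hψc : HasCompactSupport ψ) :
    ∫ x, fderiv ℝ ψ x (V x) = -divergence V * ∫ x, ψ x := by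
  set T : Fin N → Fin 2 → Config N →L[ℝ] ℂ := fun i a => Complex.ofRealCLM.comp
    ((EuclideanSpace.proj (𝕜 := ℝ) a).comp ((ContinuousLinearMap.proj i).comp V)) with hT
  have hTV : ∀ i a x, T i a x = (V x i a : ℂ) := fun i a x => rfl
  have hψf : ∀ v, Continuous fun x => fderiv ℝ ψ x v := fun v => by
    have := hψ.continuous_fderiv (by simp)
    fun_prop
  have hi : ∀ i a, Integrable fun x => T i a x *
      fderiv ℝ ψ x (Pi.single i (EuclideanSpace.single a 1)) := fun i a =>
    Continuous.integrable_of_hasCompactSupport ((T i a).continuous.mul (hψf _))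
      ((hψc.fderiv_apply (𝕜 := ℝ) _).mul_left)
  have hψi : Integrable ψ := hψ.continuous.integrable_of_hasCompactSupport hψc
  have hparts : ∀ i a, ∫ x, T i a x * fderiv ℝ ψ x (Pi.single i (EuclideanSpace.single a 1)) =
      -(V (Pi.single i (EuclideanSpace.single a 1)) i a : ℂ) * ∫ x, ψ x := by
    intro i a
    rw [integral_mul_fderiv_eq_neg_fderiv_mul_of_integrable (f := T i a) (g := ψ)]
    · simp only [ContinuousLinearMap.fderiv]
      rw [integral_const_mul, hTV, neg_mul]
    · simp only [ContinuousLinearMap.fderiv]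
      exact hψi.const_mul _
    · exact hi i a
    · exact Continuous.integrable_of_hasCompactSupport ((T i a).continuous.mul hψ.continuous)
        hψc.mul_left
    · exact fun x _ => (T i a).differentiableAt
    · exact fun x _ => hψ.differentiable (by simp) x
  have hsum : ∀ x, fderiv ℝ ψ x (V x) = ∑ i, ∑ a, T i a x *
      fderiv ℝ ψ x (Pi.single i (EuclideanSpace.single a 1)) := by
    intro x
    conv_lhs => rw [← sum_smul_single (V x)]
    simp only [map_sum, map_smul, Complex.real_smul, hTV]
  simp_rw [hsum]
  rw [← sum_sum_integral hi]
  simp_rw [hparts, ← Finset.sum_mul, divergence]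
  push_cast
  simp only [Finset.sum_neg_distrib]

/-- The rate of change of volumes under a linear flow is the divergence of its generator. -/
theorem LinearFlow.hasDivergence_divergence (Φ : LinearFlow (Config N)) :
    Φ.HasDivergence volume (divergence Φ.gen) := by
  intro s
  set δ := divergence Φ.gen with hδ
  -- An invertible linear map multiplies Lebesgue measure by a constant, so one bump function with
  -- positive integral determines that constant. Its transported integral `J` solves `J' = -δ J`.
  obtain ⟨χ, hχs, hχc, -, hχ1, hχ01⟩ := exists_contDiff_cutoff
    (isCompact_closedBall (0 : Config N) 1) isOpen_univ (Set.subset_univ _)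
  set ψ : Config N → ℂ := fun x => (χ x : ℂ) with hψdef
  have hψ : ContDiff ℝ ∞ ψ := Complex.ofRealCLM.contDiff.comp hχs
  have hψc : HasCompactSupport ψ := hχc.comp_left (g := Complex.ofReal) (by simp)
  have hχpos : 0 < ∫ x, χ x :=
    hχs.continuous.integral_pos_of_hasCompactSupport_nonneg_nonzero hχc (fun x => (hχ01 x).1)
      (x := 0) (by rw [hχ1 0 (by simp)]; norm_num)
  have hint : ∫ x, ψ x = ((∫ x, χ x : ℝ) : ℂ) := integral_complex_ofReal
  set J : ℝ → ℂ := fun s => ∫ x, ψ (Φ.flow s x) with hJ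
  have hJd : ∀ s, HasDerivAt J (-δ * J s) s := by
    intro s
    have h := Φ.hasDerivAt_integral_mul_comp_flow (μ := volume) (f := fun _ => (1 : ℂ))
      (locallyIntegrable_const 1) hψ hψc s
    simp only [one_mul] at h
    refine h.congr_deriv ?_
    have h2 := integral_fderiv_apply_gen Φ.gen (hψ.comp (Φ.flow s).contDiff)
      (hψc.comp_homeomorph (Φ.homeo s))
    simp only [← Φ.fderiv_comp_flow hψ]
    exact h2
  have hconst : ∀ s, (Real.exp (δ * s) : ℂ) * J s = J 0 := by
    have hd : ∀ s, HasDerivAt (fun s : ℝ => (Real.exp (δ * s) : ℂ) * J s) 0 s := by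
      intro s
      have h1 : HasDerivAt (fun s : ℝ => ((Real.exp (δ * s) : ℝ) : ℂ))
          ((Real.exp (δ * s) * δ : ℝ) : ℂ) s := by
        have := ((hasDerivAt_id s).const_mul δ).exp.ofReal_comp
        simpa using this
      refine (h1.mul (hJd s)).congr_deriv ?_
      push_cast
      ring
    intro s
    have := is_const_of_deriv_eq_zero (fun s => (hd s).differentiableAt) (fun s => (hd s).deriv) s 0
    simpa using this
  have hdet : LinearMap.det (Φ.flow s : Config N →ₗ[ℝ] Config N) ≠ 0 := by
    have hcomp : (Φ.flow s : Config N →ₗ[ℝ] Config N) ∘ₗ (Φ.flow (-s) : Config N →ₗ[ℝ] Config N) =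
        LinearMap.id := LinearMap.ext fun x => Φ.flow_flow_neg s x
    intro h0
    have := congrArg LinearMap.det hcomp
    rw [LinearMap.det_comp, h0, zero_mul, LinearMap.det_id] at this
    exact zero_ne_one this
  have hmap := Measure.map_linearMap_addHaar_eq_smul_addHaar (volume : Measure (Config N)) hdet
  set k : ℝ := |(LinearMap.det (Φ.flow s : Config N →ₗ[ℝ] Config N))⁻¹| with hk
  have hmap' : Measure.map (Φ.flow s) volume = ENNReal.ofReal k • (volume : Measure (Config N)) :=
    hmap
  have hJk : J s = k * ∫ x, ψ x := by
    have := (Φ.homeo s).measurableEmbedding.integral_map (μ := volume) ψ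
    rw [show ⇑(Φ.homeo s) = Φ.flow s from rfl, hmap', integral_smul_measure,
      ENNReal.toReal_ofReal (abs_nonneg _), Complex.real_smul] at this
    exact this.symm
  have hJ0 : J 0 = ∫ x, ψ x := by simp only [hJ, Φ.flow_zero]
  have h1 := hconst s
  rw [hJk, hJ0, hint] at h1
  have h2 : Real.exp (δ * s) * (k * ∫ x, χ x) = ∫ x, χ x := by exact_mod_cast h1
  have h3 : Real.exp (δ * s) * k = 1 := by
    have : (Real.exp (δ * s) * k) * ∫ x, χ x = 1 * ∫ x, χ x := by linarith
    exact mul_right_cancel₀ hχpos.ne' this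
  rw [hmap', Real.exp_neg, eq_inv_of_mul_eq_one_right h3]

end Divergence

/-! ### Weighted Cauchy–Schwarz and averages over orbits -/

/-- A weighted Cauchy–Schwarz inequality. -/
theorem norm_integral_mul_sq_le {X : Type*} [MeasurableSpace X] {μ : Measure X} {u v : X → ℂ}
    {W R : X → ℝ} (hW : ∀ x, 0 ≤ W x) (hR : ∀ x, 0 ≤ R x) (hu : ∀ x, ‖u x‖ ^ 2 ≤ W x * R x)
    (hRi : Integrable R μ) (hv : Integrable (fun x => W x * ‖v x‖ ^ 2) μ) :
    ‖∫ x, u x * v x ∂μ‖ ^ 2 ≤ (∫ x, R x ∂μ) * ∫ x, W x * ‖v x‖ ^ 2 ∂μ := by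
  set p : X → ℝ := fun x => √(R x)
  set q : X → ℝ := fun x => √(W x * ‖v x‖ ^ 2)
  have hq0 : ∀ x, 0 ≤ W x * ‖v x‖ ^ 2 := fun x => mul_nonneg (hW x) (by positivity)
  have hp2 : ∀ x, p x ^ 2 = R x := fun x => Real.sq_sqrt (hR x)
  have hq2 : ∀ x, q x ^ 2 = W x * ‖v x‖ ^ 2 := fun x => Real.sq_sqrt (hq0 x)
  have hpm : MemLp p 2 μ := by
    rw [memLp_two_iff_integrable_sq (Real.continuous_sqrt.comp_aestronglyMeasurable hRi.1)]
    exact hRi.congr (Filter.Eventually.of_forall fun x => (hp2 x).symm)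
  have hqm : MemLp q 2 μ := by
    rw [memLp_two_iff_integrable_sq (Real.continuous_sqrt.comp_aestronglyMeasurable hv.1)]
    exact hv.congr (Filter.Eventually.of_forall fun x => (hq2 x).symm)
  have h1 : ‖∫ x, u x * v x ∂μ‖ ≤ ∫ x, p x * q x ∂μ := by
    refine (norm_integral_le_integral_norm _).trans ?_
    refine integral_mono_of_nonneg (Filter.Eventually.of_forall fun x => norm_nonneg _)
      (MemLp.integrable_mul (p := 2) (q := 2) hpm hqm) (Filter.Eventually.of_forall fun x => ?_)
    refine abs_le_of_sq_le_sq' ?_ (mul_nonneg (Real.sqrt_nonneg _) (Real.sqrt_nonneg _)) |>.2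
    change ‖u x * v x‖ ^ 2 ≤ (p x * q x) ^ 2
    rw [norm_mul, mul_pow, mul_pow, hp2, hq2]
    calc ‖u x‖ ^ 2 * ‖v x‖ ^ 2 ≤ (W x * R x) * ‖v x‖ ^ 2 :=
          mul_le_mul_of_nonneg_right (hu x) (by positivity)
      _ = _ := by ring
  have h2 := integral_mul_le_Lp_mul_Lq_of_nonneg (μ := μ) Real.HolderConjugate.two_two
    (Filter.Eventually.of_forall fun x => Real.sqrt_nonneg (R x))
    (Filter.Eventually.of_forall fun x => Real.sqrt_nonneg (W x * ‖v x‖ ^ 2))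
    (by rw [ENNReal.ofReal_ofNat]; exact hpm) (by rw [ENNReal.ofReal_ofNat]; exact hqm)
  simp only [Real.rpow_two, ← Real.sqrt_eq_rpow] at h2
  change ∫ x, p x * q x ∂μ ≤ √(∫ x, p x ^ 2 ∂μ) * √(∫ x, q x ^ 2 ∂μ) at h2
  simp only [hp2, hq2] at h2
  calc ‖∫ x, u x * v x ∂μ‖ ^ 2 ≤ (√(∫ x, R x ∂μ) * √(∫ x, W x * ‖v x‖ ^ 2 ∂μ)) ^ 2 :=
        pow_le_pow_left₀ (norm_nonneg _) (h1.trans h2) 2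
    _ = _ := by
        rw [mul_pow, Real.sq_sqrt (integral_nonneg hR), Real.sq_sqrt (integral_nonneg hq0)]

namespace LinearFlow

variable {E : Type*} [NormedAddCommGroup E] [NormedSpace ℝ E] [FiniteDimensional ℝ E]
  [MeasurableSpace E] [BorelSpace E] (Φ : LinearFlow E)

/-- Fubini, valid because the supports for times in `[0, b]` stay in one compact set. It moves a
time average of pairings onto the test function. -/
theorem integral_mul_integral_comp_flow {𝕜 : Type*} [RCLike 𝕜] {μ : Measure E} [SFinite μ]
    {f : E → 𝕜} (hf : LocallyIntegrable f μ) {u : E → 𝕜} (hu : Continuous u)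
    (huc : HasCompactSupport u) {k : ℝ → 𝕜} (hk : Continuous k) {b : ℝ} (hb : 0 ≤ b) :
    ∫ s in (0 : ℝ)..b, k s * ∫ x, f x * u (Φ.flow s x) ∂μ =
      ∫ x, f x * (∫ s in (0 : ℝ)..b, k s * u (Φ.flow s x)) ∂μ := by
  set K := (fun p : ℝ × E => Φ.flow p.1 p.2) '' (Set.Icc (-b) 0 ×ˢ tsupport u)
  have hKc : IsCompact K := Φ.isCompact_orbit huc _ _
  have hmem : ∀ t ∈ Set.Ioc 0 b, ∀ x, Φ.flow t x ∈ tsupport u → x ∈ K := fun t ht x hx =>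
    ⟨(-t, Φ.flow t x), ⟨⟨by linarith [ht.2], by linarith [ht.1]⟩, hx⟩, Φ.flow_neg_flow t x⟩
  obtain ⟨C, hC⟩ := hu.bounded_above_of_compact_support huc
  obtain ⟨D, hD⟩ := isCompact_Icc.exists_bound_of_continuousOn (hk.continuousOn (s := Set.Icc 0 b))
  have hD0 : 0 ≤ D := (norm_nonneg _).trans (hD 0 ⟨le_rfl, hb⟩)
  have hint : Integrable (Function.uncurry fun (s : ℝ) (x : E) => k s * (f x * u (Φ.flow s x)))
      ((volume.restrict (Set.Ioc 0 b)).prod μ) := by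
    have hbd : Integrable (K.indicator fun x => D * (‖f x‖ * C)) μ :=
      (integrable_indicator_iff hKc.measurableSet).2
        (((hf.integrableOn_isCompact hKc).norm.mul_const C).const_mul D)
    refine (hbd.comp_snd (volume.restrict (Set.Ioc 0 b))).mono' ?_ ?_
    · have h1 : AEStronglyMeasurable (fun z : ℝ × E => f z.2)
          ((volume.restrict (Set.Ioc 0 b)).prod μ) := hf.aestronglyMeasurable.comp_snd
      have h2 : Continuous fun z : ℝ × E => u (Φ.flow z.1 z.2) := hu.comp Φ.continuous_flow
      have h3 : Continuous fun z : ℝ × E => k z.1 := by fun_prop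
      exact h3.aestronglyMeasurable.mul (h1.mul h2.aestronglyMeasurable)
    · have hae : ∀ᵐ z ∂((volume.restrict (Set.Ioc 0 b)).prod μ), z.1 ∈ Set.Ioc 0 b :=
        Measure.quasiMeasurePreserving_fst.ae (ae_restrict_mem measurableSet_Ioc)
      filter_upwards [hae] with z hz
      simp only [Function.uncurry]
      by_cases hx : z.2 ∈ K
      · rw [Set.indicator_of_mem hx, norm_mul, norm_mul]
        gcongr
        · exact hD _ ⟨hz.1.le, hz.2⟩
        · exact hC _
      · rw [image_eq_zero_of_notMem_tsupport fun h => hx (hmem z.1 hz z.2 h)]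
        simp [Set.indicator_of_notMem hx]
  have := integral_integral_swap hint
  simp only [intervalIntegral.integral_of_le hb]
  simp only [integral_const_mul] at this
  rw [this]
  refine integral_congr_ae (Filter.Eventually.of_forall fun x => ?_)
  simp only [← integral_const_mul]
  refine integral_congr_ae (Filter.Eventually.of_forall fun s => ?_)
  ring

/-- Averaging over a measure preserving flow. -/
theorem integral_mul_average {μ : Measure E} [IsFiniteMeasureOnCompacts μ] [SFinite μ]
    (hdiv : Φ.HasDivergence μ 0) {W u : E → ℝ} (hW : Continuous W)
    (hWinv : ∀ s x, W (Φ.flow s x) = W x) (hu : Continuous u) (huc : HasCompactSupport u) {b : ℝ}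
    (hb : 0 ≤ b) :
    ∫ x, W x * (∫ s in (0 : ℝ)..b, u (Φ.flow s x)) ∂μ = b * ∫ x, W x * u x ∂μ := by
  have h := Φ.integral_mul_integral_comp_flow (μ := μ) (f := W) hW.locallyIntegrable hu huc
    (continuous_const (y := (1 : ℝ))) hb
  simp only [one_mul] at h
  rw [← h]
  have h2 : ∀ s, ∫ x, W x * u (Φ.flow s x) ∂μ = ∫ x, W x * u x ∂μ := by
    intro s
    have := hdiv.integral_comp (fun x => W x * u x) s
    simpa [hWinv] using this
  simp [h2]

end LinearFlow

/-! ### Pairing estimates for gauged flows -/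

/-- A linear flow on configuration space together with an invariant region of configurations
without coincidences, a gauge transformation `g` which makes the vector potential constant along
the flow, and a weight `W`. -/
structure GaugedFlow (N : ℕ) (α : ℝ) where
  /-- The flow. -/
  Φ : LinearFlow (Config N)
  /-- The rate of contraction of volumes. -/
  δ : ℝ
  divergence_eq : divergence Φ.gen = δ
  /-- The invariant region. -/
  U : Set (Config N)
  isOpen : IsOpen U
  subset : U ⊆ (diagonals N)ᶜ
  invariant : ∀ s, ∀ x ∈ U, Φ.flow s x ∈ U
  /-- The gauge transformation. -/
  g : Config N → ℂ
  measurable : Measurable g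
  norm_eq_one : ∀ x, ‖g x‖ = 1
  contDiffOn : ContDiffOn ℝ ∞ g U
  /-- The remaining vector potential. -/
  c : ℝ
  gauge : ∀ x ∈ U, Complex.I * fderiv ℝ g x (Φ.gen x) +
    (α * potentialAlong Φ.gen x : ℝ) * g x = c * g x
  /-- The weight. -/
  W : Config N → ℝ
  contDiff_weight : ContDiff ℝ ∞ W
  weight_nonneg : ∀ x, 0 ≤ W x
  weight_pos : ∀ x ∈ U, 0 < W x

namespace GaugedFlow

variable {N : ℕ} {α : ℝ} (Γ : GaugedFlow N α)

theorem hasDivergence : Γ.Φ.HasDivergence volume Γ.δ :=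
  Γ.divergence_eq ▸ Γ.Φ.hasDivergence_divergence

theorem memLp_mul_gauge {φ : Config N → ℂ} (hφ : MemLp φ 2 volume) :
    MemLp (fun x => φ x * Γ.g x) 2 volume :=
  hφ.mono (hφ.1.mul Γ.measurable.aestronglyMeasurable)
    (Filter.Eventually.of_forall fun x => by simp [Γ.norm_eq_one])

/-- The weak equation becomes a scalar linear ODE in the flow time. The rate `δ` comes from
integrating by parts and `c` from the potential that the gauge leaves over. -/
theorem hasDerivAt_pairing {φ : Config N → ℂ} (hφ : MemLp φ 2 volume)
    {G : Fin N → Config N → EuclideanSpace ℂ (Fin 2)} (hG : ∀ j, MemLp (G j) 2 volume)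
    (hD : ∀ j, IsMagneticDeriv α j φ (G j)) {ψ : Config N → ℂ} (hψ : IsBump Γ.U ψ) (s : ℝ) :
    HasDerivAt (fun s => ∫ x, φ x * Γ.g x * ψ (Γ.Φ.flow s x))
      (-Complex.I * (∫ x, derivAlong Γ.Φ.gen G x * Γ.g x * ψ (Γ.Φ.flow s x)) -
        (Γ.δ - Complex.I * Γ.c) * ∫ x, φ x * Γ.g x * ψ (Γ.Φ.flow s x)) s := by
  have hf := Γ.memLp_mul_gauge hφ
  have h := Γ.Φ.hasDerivAt_integral_mul_comp_flow (hf.locallyIntegrable (by simp)) hψ.smooth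
    hψ.compact s
  refine h.congr_deriv ?_
  have hb := Γ.Φ.isBump_comp_flow Γ.invariant hψ s
  have key := integral_derivAlong_mul hφ hG hD Γ.Φ.gen Γ.isOpen Γ.subset Γ.contDiffOn Γ.gauge hb
  simp only [Γ.Φ.fderiv_comp_flow hψ.smooth, Γ.divergence_eq] at key
  have i1 : Integrable fun x => φ x * Γ.g x * ψ (Γ.Φ.flow s x) := integrable_mul_bump hf hb
  have i2 : Integrable fun x => φ x * Γ.g x *
      fderiv ℝ ψ (Γ.Φ.flow s x) (Γ.Φ.gen (Γ.Φ.flow s x)) := by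
    simp only [← Γ.Φ.fderiv_comp_flow hψ.smooth]
    refine MemLp.integrable_mul (p := 2) (q := 2) hf (Continuous.memLp_of_hasCompactSupport ?_ ?_)
    · have := hb.smooth.continuous_fderiv (by simp)
      fun_prop
    · refine HasCompactSupport.of_support_subset_isCompact hb.compact fun y hy => ?_
      by_contra hc
      refine hy ?_
      simp only
      rw [image_eq_zero_of_notMem_tsupport fun h => hc (tsupport_fderiv_subset ℝ h)]
      simp
  have e : ∫ x, φ x * (Γ.g x * (Complex.I * fderiv ℝ ψ (Γ.Φ.flow s x) (Γ.Φ.gen (Γ.Φ.flow s x)) +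
      (Complex.I * Γ.δ + Γ.c) * ψ (Γ.Φ.flow s x))) =
      Complex.I * (∫ x, φ x * Γ.g x * fderiv ℝ ψ (Γ.Φ.flow s x) (Γ.Φ.gen (Γ.Φ.flow s x))) +
      (Complex.I * Γ.δ + Γ.c) * ∫ x, φ x * Γ.g x * ψ (Γ.Φ.flow s x) := by
    rw [← integral_const_mul, ← integral_const_mul, ← integral_add (i2.const_mul _)
      (i1.const_mul _)]
    refine integral_congr_ae (Filter.Eventually.of_forall fun x => ?_)
    ring
  rw [e] at key
  simp only [← mul_assoc] at key
  rw [key]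
  linear_combination ((∫ x, φ x * Γ.g x * fderiv ℝ ψ (Γ.Φ.flow s x) (Γ.Φ.gen (Γ.Φ.flow s x))) +
    Γ.δ * ∫ x, φ x * Γ.g x * ψ (Γ.Φ.flow s x)) * Complex.I_sq

theorem norm_derivAlong_mul_gauge {G : Fin N → Config N → EuclideanSpace ℂ (Fin 2)} {R : Config N → ℝ}
    (hR : ∀ x, ‖derivAlong Γ.Φ.gen G x‖ ^ 2 ≤ Γ.W x * R x) (x : Config N) :
    ‖derivAlong Γ.Φ.gen G x * Γ.g x‖ ^ 2 ≤ Γ.W x * R x := by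
  simpa [Γ.norm_eq_one] using hR x

theorem integrable_weight_mul_sq {v : Config N → ℂ} (hv : Continuous v) (hvc : HasCompactSupport v) :
    Integrable (fun x => Γ.W x * ‖v x‖ ^ 2) := by
  refine Continuous.integrable_of_hasCompactSupport ?_ ?_
  · have := Γ.contDiff_weight.continuous
    fun_prop
  · exact (hvc.comp_left (g := fun t : ℂ => ‖t‖ ^ 2) (by simp)).mul_left (f := Γ.W)

/-- The pairing estimate for a flow that expands volumes and the weight. -/
theorem norm_pairing_sq_le_of_dilation (hδ : Γ.δ = 4) (hc : Γ.c = 0)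
    (hWs : ∀ s x, Γ.W (Γ.Φ.flow s x) = Real.exp (2 * s) * Γ.W x)
    {φ : Config N → ℂ} (hφ : MemLp φ 2 volume)
    {G : Fin N → Config N → EuclideanSpace ℂ (Fin 2)} (hG : ∀ j, MemLp (G j) 2 volume)
    (hD : ∀ j, IsMagneticDeriv α j φ (G j)) {R : Config N → ℝ} (hR0 : ∀ x, 0 ≤ R x)
    (hRi : Integrable R) (hR : ∀ x, ‖derivAlong Γ.Φ.gen G x‖ ^ 2 ≤ Γ.W x * R x)
    {ψ : Config N → ℂ} (hψ : IsBump Γ.U ψ) :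
    ‖∫ x, φ x * Γ.g x * ψ x‖ ^ 2 ≤ (∫ x, R x) * ∫ x, Γ.W x * ‖ψ x‖ ^ 2 := by
  set F : ℝ → ℂ := fun s => ∫ x, φ x * Γ.g x * ψ (Γ.Φ.flow s x) with hF
  set H : ℝ → ℂ := fun s => ∫ x, derivAlong Γ.Φ.gen G x * Γ.g x * ψ (Γ.Φ.flow s x) with hH
  set Q : ℝ := ∫ x, Γ.W x * ‖ψ x‖ ^ 2 with hQ
  have hQ0 : 0 ≤ Q := integral_nonneg fun x => mul_nonneg (Γ.weight_nonneg x) (by positivity)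
  have hRint0 : 0 ≤ ∫ x, R x := integral_nonneg hR0
  set M : ℝ := √((∫ x, R x) * Q) with hM
  have hM2 : M ^ 2 = (∫ x, R x) * Q := Real.sq_sqrt (by positivity)
  have hM0 : 0 ≤ M := Real.sqrt_nonneg _
  -- The volume factor `e^{-4s}` and the scaling `e^{2s}` of `W` combine to `∫ W ‖ψ ∘ Φ_s‖² =
  -- e^{-6s} Q`; the rate `3` is half of `6`.
  have hHs : ∀ s, ‖H s‖ ≤ M * Real.exp (-(3 * s)) := by
    intro s
    have hb := Γ.Φ.isBump_comp_flow Γ.invariant hψ s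
    have h1 := norm_integral_mul_sq_le Γ.weight_nonneg hR0 (Γ.norm_derivAlong_mul_gauge hR) hRi
      (Γ.integrable_weight_mul_sq hb.smooth.continuous hb.compact)
    have h2 : ∫ x, Γ.W x * ‖ψ (Γ.Φ.flow s x)‖ ^ 2 = Real.exp (-(6 * s)) * Q := by
      have h3 := Γ.hasDivergence.integral_comp (fun x => Γ.W x * ‖ψ x‖ ^ 2) s
      simp only [hWs, hδ, smul_eq_mul, mul_assoc, integral_const_mul] at h3
      have e6 : Real.exp (-(6 * s)) = Real.exp (-(2 * s)) * Real.exp (-(4 * s)) := by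
        rw [← Real.exp_add]; congr 1; ring
      rw [e6, mul_assoc, ← h3, ← mul_assoc, ← Real.exp_add]
      simp
    rw [h2] at h1
    refine abs_le_of_sq_le_sq' ?_ (by positivity) |>.2
    rw [mul_pow, hM2, ← Real.exp_nat_mul]
    refine h1.trans (le_of_eq ?_)
    have : ((2 : ℕ) : ℝ) * -(3 * s) = -(6 * s) := by push_cast; ring
    rw [this]; ring
  set A : ℝ := (∫ x, ‖φ x‖ ^ 2) * ∫ x, ‖ψ x‖ ^ 2 with hA
  have hA0 : 0 ≤ A := mul_nonneg (integral_nonneg fun x => by positivity)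
    (integral_nonneg fun x => by positivity)
  -- A crude bound with a constant depending on `φ` and `ψ`. It serves only to make the boundary
  -- term at `-∞` vanish.
  have hFs : ∀ s, ‖F s‖ ≤ √A * Real.exp (-(2 * s)) := by
    intro s
    have hb := Γ.Φ.isBump_comp_flow Γ.invariant hψ s
    have hbm : MemLp (fun x => ψ (Γ.Φ.flow s x)) 2 volume :=
      hb.smooth.continuous.memLp_of_hasCompactSupport hb.compact
    have h1 := norm_integral_mul_sq_le (μ := volume) (W := fun _ => 1) (R := fun x => ‖φ x‖ ^ 2)
      (u := fun x => φ x * Γ.g x) (v := fun x => ψ (Γ.Φ.flow s x))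
      (fun _ => zero_le_one) (fun x => by positivity) (fun x => by simp [Γ.norm_eq_one])
      ((memLp_two_iff_integrable_sq_norm hφ.1).1 hφ)
      (by simpa using (memLp_two_iff_integrable_sq_norm hbm.1).1 hbm)
    simp only [one_mul] at h1
    have h3 := Γ.hasDivergence.integral_comp (fun x => ‖ψ x‖ ^ 2) s
    rw [h3, hδ, smul_eq_mul] at h1
    refine abs_le_of_sq_le_sq' ?_ (by positivity) |>.2
    rw [mul_pow, Real.sq_sqrt hA0, ← Real.exp_nat_mul]
    refine h1.trans (le_of_eq ?_)
    have : ((2 : ℕ) : ℝ) * -(2 * s) = -(4 * s) := by push_cast; ring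
    rw [this, hA]; ring
  set P : ℝ → ℂ := fun s => (Real.exp (4 * s) : ℂ) * F s with hP
  have hPd : ∀ s, HasDerivAt P (-Complex.I * ((Real.exp (4 * s) : ℝ) : ℂ) * H s) s := by
    intro s
    have h1 : HasDerivAt (fun s : ℝ => ((Real.exp (4 * s) : ℝ) : ℂ))
        ((Real.exp (4 * s) * 4 : ℝ) : ℂ) s := by
      have := ((hasDerivAt_id s).const_mul (4 : ℝ)).exp.ofReal_comp
      simpa using this
    refine (h1.mul (Γ.hasDerivAt_pairing hφ hG hD hψ s)).congr_deriv ?_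
    rw [hδ, hc]
    push_cast
    ring
  -- Since `‖P'‖ ≤ M e^s` and `‖P (-T)‖ ≤ √A e^{-2T}`, integrate over `[-T, 0]`. The Hardy constant
  -- one is `∫ e^s` over the negative half-line.
  have hPT : ∀ T : ℝ, 0 ≤ T → ‖F 0‖ ≤ M + √A * Real.exp (-(2 * T)) := by
    intro T hT
    have hB : ∀ s : ℝ, HasDerivAt (fun s => √A * Real.exp (-(2 * T)) + M * Real.exp s)
        (M * Real.exp s) s := fun s => ((Real.hasDerivAt_exp s).const_mul M).const_add _
    have h1 := image_norm_le_of_norm_deriv_right_le_deriv_boundary (f := P) (a := -T) (b := 0)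
      (fun s _ => (hPd s).continuousAt.continuousWithinAt) (fun s _ => (hPd s).hasDerivWithinAt)
      (B := fun s => √A * Real.exp (-(2 * T)) + M * Real.exp s) ?_ hB ?_
      (x := 0) ⟨by linarith, le_rfl⟩
    · simp only [hP, mul_zero, Real.exp_zero, Complex.ofReal_one, one_mul, mul_one] at h1
      linarith
    · simp only [hP, norm_mul, Complex.norm_real, Real.norm_eq_abs, Real.abs_exp]
      have h2 : Real.exp (4 * -T) * ‖F (-T)‖ ≤ Real.exp (4 * -T) * (√A * Real.exp (-(2 * -T))) :=
        mul_le_mul_of_nonneg_left (hFs _) (Real.exp_pos _).le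
      have h3 : Real.exp (4 * -T) * (√A * Real.exp (-(2 * -T))) = √A * Real.exp (-(2 * T)) := by
        rw [mul_left_comm, ← Real.exp_add]; congr 2; ring
      have h4 : 0 ≤ M * Real.exp (-T) := by positivity
      linarith
    · intro s _
      simp only [norm_mul, norm_neg, Complex.norm_I, one_mul, Complex.norm_real, Real.norm_eq_abs,
        Real.abs_exp]
      have h2 : Real.exp (4 * s) * ‖H s‖ ≤ Real.exp (4 * s) * (M * Real.exp (-(3 * s))) :=
        mul_le_mul_of_nonneg_left (hHs _) (Real.exp_pos _).le
      have h3 : Real.exp (4 * s) * (M * Real.exp (-(3 * s))) = M * Real.exp s := by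
        rw [mul_left_comm, ← Real.exp_add]; congr 2; ring
      linarith
  have hlim : Filter.Tendsto (fun T : ℝ => M + √A * Real.exp (-(2 * T))) Filter.atTop
      (nhds (M + √A * 0)) := by
    refine ((Real.tendsto_exp_atBot.comp ?_).const_mul _).const_add _
    exact Filter.tendsto_neg_atTop_atBot.comp
      (Filter.Tendsto.const_mul_atTop (by norm_num) Filter.tendsto_id)
  have hfin : ‖F 0‖ ≤ M := by
    have := ge_of_tendsto hlim ((Filter.eventually_ge_atTop 0).mono hPT)
    simpa using this
  have hF0 : F 0 = ∫ x, φ x * Γ.g x * ψ x := by simp only [hF, Γ.Φ.flow_zero]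
  rw [← hF0, ← hM2]
  exact pow_le_pow_left₀ (norm_nonneg _) hfin 2

theorem locallyIntegrable_derivAlong_mul_gauge {G : Fin N → Config N → EuclideanSpace ℂ (Fin 2)}
    (hG : ∀ j, MemLp (G j) 2 volume) :
    LocallyIntegrable (fun x => derivAlong Γ.Φ.gen G x * Γ.g x) := by
  have hGa : ∀ i a, MemLp (fun x => G i x a) 2 volume := fun i a =>
    (EuclideanSpace.proj (𝕜 := ℂ) a).comp_memLp' (hG i)
  have h : ∀ i a, LocallyIntegrable (fun x => G i x a * Γ.g x * ((Γ.Φ.gen x i a : ℝ) : ℂ)) := by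
    intro i a
    refine LocallyIntegrable.mul_continuous (by fun_prop) ?_
    exact (Γ.memLp_mul_gauge (hGa i a)).locallyIntegrable (by simp)
  have h2 : (fun x => derivAlong Γ.Φ.gen G x * Γ.g x) =
      fun x => ∑ i, ∑ a, G i x a * Γ.g x * ((Γ.Φ.gen x i a : ℝ) : ℂ) := by
    funext x
    simp only [derivAlong, Finset.sum_mul]
    exact Finset.sum_congr rfl fun i _ => Finset.sum_congr rfl fun a _ => by ring
  rw [h2]
  exact locallyIntegrable_finsetSum _ fun i _ => locallyIntegrable_finsetSum _ fun a _ => h i a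

section Average

variable {ψ : Config N → ℂ}

theorem continuous_orbit_integral (hψ : Continuous ψ) :
    Continuous fun x => ∫ s in (0 : ℝ)..Real.pi,
      Complex.exp (-(Complex.I * α * s)) * ψ (Γ.Φ.flow s x) := by
  refine intervalIntegral.continuous_parametric_intervalIntegral_of_continuous' ?_ _ _
  have h1 : Continuous fun p : Config N × ℝ => ψ (Γ.Φ.flow p.2 p.1) :=
    hψ.comp (Γ.Φ.continuous_flow.comp continuous_swap)
  have h2 : Continuous fun p : Config N × ℝ => Complex.exp (-(Complex.I * α * p.2)) := by fun_prop
  exact h2.mul h1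

theorem hasCompactSupport_orbit_integral (hψ : HasCompactSupport ψ) :
    HasCompactSupport fun x => ∫ s in (0 : ℝ)..Real.pi,
      Complex.exp (-(Complex.I * α * s)) * ψ (Γ.Φ.flow s x) := by
  refine HasCompactSupport.of_support_subset_isCompact
    (Γ.Φ.isCompact_orbit hψ (-Real.pi) 0) fun x hx => ?_
  by_contra hxK
  refine hx ?_
  have : ∀ s ∈ Set.uIcc 0 Real.pi, Complex.exp (-(Complex.I * α * s)) * ψ (Γ.Φ.flow s x) =
      (fun _ => (0 : ℂ)) s := by
    intro s hs
    rw [Set.uIcc_of_le Real.pi_pos.le] at hs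
    rw [image_eq_zero_of_notMem_tsupport (f := ψ), mul_zero]
    intro h
    exact hxK ⟨(-s, Γ.Φ.flow s x), ⟨⟨by linarith [hs.2], by linarith [hs.1]⟩, h⟩,
      Γ.Φ.flow_neg_flow s x⟩
  exact (intervalIntegral.integral_congr this).trans (by simp)

/-- The circle estimate holds on each orbit. Weight and volume are invariant, so integrating over
configurations after averaging over the orbit only multiplies both sides by `π`. -/
theorem mul_integral_weight_orbit_integral_le (hδ : Γ.δ = 0)
    (hWs : ∀ s x, Γ.W (Γ.Φ.flow s x) = Γ.W x) {m : ℝ} (hm : ∀ q : ℤ, m ≤ |α - 2 * q| ^ 2)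
    (hψ : Continuous ψ) (hψc : HasCompactSupport ψ)
    (hper : ∀ x, ψ (Γ.Φ.flow Real.pi x) = ψ x) :
    m * ∫ x, Γ.W x * ‖∫ s in (0 : ℝ)..Real.pi,
        Complex.exp (-(Complex.I * α * s)) * ψ (Γ.Φ.flow s x)‖ ^ 2 ≤
      ‖Complex.exp (-(Complex.I * α * Real.pi)) - 1‖ ^ 2 * ∫ x, Γ.W x * ‖ψ x‖ ^ 2 := by
  set Y : Config N → ℂ := fun x => ∫ s in (0 : ℝ)..Real.pi,
    Complex.exp (-(Complex.I * α * s)) * ψ (Γ.Φ.flow s x) with hY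
  have hYc : Continuous Y := Γ.continuous_orbit_integral hψ
  have hYs : HasCompactSupport Y := Γ.hasCompactSupport_orbit_integral hψc
  have hdiv := Γ.hasDivergence
  rw [hδ] at hdiv
  have hWc := Γ.contDiff_weight.continuous
  have avg : ∀ v : Config N → ℂ, Continuous v → HasCompactSupport v →
      ∫ x, Γ.W x * (∫ s in (0 : ℝ)..Real.pi, ‖v (Γ.Φ.flow s x)‖ ^ 2) =
        Real.pi * ∫ x, Γ.W x * ‖v x‖ ^ 2 := fun v hv hvc =>
    Γ.Φ.integral_mul_average hdiv hWc hWs (u := fun x => ‖v x‖ ^ 2) (by fun_prop)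
      (hvc.comp_left (g := fun t : ℂ => ‖t‖ ^ 2) (by simp)) Real.pi_pos.le
  have int : ∀ v : Config N → ℂ, Continuous v → HasCompactSupport v →
      Integrable fun x => Γ.W x * (∫ s in (0 : ℝ)..Real.pi, ‖v (Γ.Φ.flow s x)‖ ^ 2) := by
    intro v hv hvc
    refine Continuous.integrable_of_hasCompactSupport ?_ ?_
    · refine hWc.mul (intervalIntegral.continuous_parametric_intervalIntegral_of_continuous' ?_ _ _)
      have h1 : Continuous fun p : Config N × ℝ => v (Γ.Φ.flow p.2 p.1) :=
        hv.comp (Γ.Φ.continuous_flow.comp continuous_swap)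
      exact h1.norm.pow 2
    · refine HasCompactSupport.mul_left (f := Γ.W) ?_
      refine HasCompactSupport.of_support_subset_isCompact
        (Γ.Φ.isCompact_orbit hvc (-Real.pi) 0) fun x hx => ?_
      by_contra hxK
      refine hx ?_
      have : ∀ s ∈ Set.uIcc 0 Real.pi, ‖v (Γ.Φ.flow s x)‖ ^ 2 = (fun _ => (0 : ℝ)) s := by
        intro s hs
        rw [Set.uIcc_of_le Real.pi_pos.le] at hs
        rw [image_eq_zero_of_notMem_tsupport (f := v)]
        · simp
        intro h
        exact hxK ⟨(-s, Γ.Φ.flow s x), ⟨⟨by linarith [hs.2], by linarith [hs.1]⟩, h⟩,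
          Γ.Φ.flow_neg_flow s x⟩
      exact (intervalIntegral.integral_congr this).trans (by simp)
  have hpt : ∀ x, m * (∫ t in (0 : ℝ)..Real.pi, ‖Y (Γ.Φ.flow t x)‖ ^ 2) ≤
      ‖Complex.exp (-(Complex.I * α * Real.pi)) - 1‖ ^ 2 *
        ∫ t in (0 : ℝ)..Real.pi, ‖ψ (Γ.Φ.flow t x)‖ ^ 2 := by
    intro x
    have h1 : Continuous fun t : ℝ => ψ (Γ.Φ.flow t x) :=
      hψ.comp (Γ.Φ.continuous_flow.comp (by fun_prop : Continuous fun t : ℝ => (t, x)))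
    have := mul_integral_sq_average_le hm h1 fun t => by
      rw [add_comm, Γ.Φ.flow_add, hper]
    simpa only [hY, Γ.Φ.flow_add] using this
  have h1 := integral_mono ((int Y hYc hYs).const_mul m)
    ((int ψ hψ hψc).const_mul (‖Complex.exp (-(Complex.I * α * Real.pi)) - 1‖ ^ 2)) fun x => by
      have := mul_le_mul_of_nonneg_left (hpt x) (Γ.weight_nonneg x)
      simp only
      linarith
  simp only [integral_const_mul] at h1
  rw [avg Y hYc hYs, avg ψ hψ hψc] at h1
  refine le_of_mul_le_mul_left (a := Real.pi) ?_ Real.pi_pos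
  linarith

end Average

/-- The pairing estimate for a rotation by multiples of `π`, for invariant test functions. -/
theorem norm_pairing_sq_le_of_rotation_of_invariant (hδ : Γ.δ = 0) (hc : Γ.c = α)
    (hWs : ∀ s x, Γ.W (Γ.Φ.flow s x) = Γ.W x) {m : ℝ} (hm0 : 0 ≤ m)
    (hm : ∀ q : ℤ, m ≤ |α - 2 * q| ^ 2)
    (hα : Complex.exp (-(Complex.I * α * Real.pi)) ≠ 1)
    {φ : Config N → ℂ} (hφ : MemLp φ 2 volume)
    {G : Fin N → Config N → EuclideanSpace ℂ (Fin 2)} (hG : ∀ j, MemLp (G j) 2 volume)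
    (hD : ∀ j, IsMagneticDeriv α j φ (G j)) {R : Config N → ℝ} (hR0 : ∀ x, 0 ≤ R x)
    (hRi : Integrable R) (hR : ∀ x, ‖derivAlong Γ.Φ.gen G x‖ ^ 2 ≤ Γ.W x * R x)
    {ψ : Config N → ℂ} (hψ : IsBump Γ.U ψ) (hper : ∀ x, ψ (Γ.Φ.flow Real.pi x) = ψ x) :
    m * ‖∫ x, φ x * Γ.g x * ψ x‖ ^ 2 ≤ (∫ x, R x) * ∫ x, Γ.W x * ‖ψ x‖ ^ 2 := by
  set F : ℝ → ℂ := fun s => ∫ x, φ x * Γ.g x * ψ (Γ.Φ.flow s x) with hF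
  set H : ℝ → ℂ := fun s => ∫ x, derivAlong Γ.Φ.gen G x * Γ.g x * ψ (Γ.Φ.flow s x) with hH
  set e : ℝ → ℂ := fun s => Complex.exp (-(Complex.I * α * s)) with he
  have hec : Continuous e := by fun_prop
  have hloc := Γ.locallyIntegrable_derivAlong_mul_gauge hG
  have hHc : Continuous H := continuous_iff_continuousAt.2 fun s =>
    (Γ.Φ.hasDerivAt_integral_mul_comp_flow hloc hψ.smooth hψ.compact s).continuousAt
  -- The integrating factor `e` absorbs `c = α`. As `F π = F 0`, integrating over one period yields
  -- `(e π - 1) J = -i ∫ e H`.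
  have hPd : ∀ s, HasDerivAt (fun s => e s * F s) (-Complex.I * (e s * H s)) s := by
    intro s
    have h1 : HasDerivAt e (e s * (-(Complex.I * α))) s := by
      have := ((hasDerivAt_id s).ofReal_comp.const_mul (Complex.I * (α : ℂ))).neg.cexp
      simpa using this
    refine (h1.mul (Γ.hasDerivAt_pairing hφ hG hD hψ s)).congr_deriv ?_
    rw [hδ, hc]
    push_cast
    ring
  have hFTC := intervalIntegral.integral_eq_sub_of_hasDerivAt (a := 0) (b := Real.pi)
    (fun s _ => hPd s) ((continuous_const.mul (hec.mul hHc)).intervalIntegrable _ _)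
  have hF0 : F 0 = ∫ x, φ x * Γ.g x * ψ x := by simp only [hF, Γ.Φ.flow_zero]
  have hFpi : F Real.pi = ∫ x, φ x * Γ.g x * ψ x := by simp only [hF, hper]
  rw [intervalIntegral.integral_const_mul, hF0, hFpi] at hFTC
  -- Now `∫ e H` is the pairing of the magnetic derivative with the orbit integral of `ψ`.
  -- Cauchy–Schwarz and the orbit estimate bound it, and the factor `‖e π - 1‖²`, nonzero by `hα`,
  -- cancels.
  have hswap := Γ.Φ.integral_mul_integral_comp_flow hloc hψ.smooth.continuous hψ.compact hec
    Real.pi_pos.le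
  change ∫ s in (0 : ℝ)..Real.pi, e s * H s = _ at hswap
  have hYc := Γ.continuous_orbit_integral hψ.smooth.continuous
  have hYs := Γ.hasCompactSupport_orbit_integral hψ.compact
  have hCS := norm_integral_mul_sq_le Γ.weight_nonneg hR0 (Γ.norm_derivAlong_mul_gauge hR) hRi
    (Γ.integrable_weight_mul_sq hYc hYs)
  have hY := Γ.mul_integral_weight_orbit_integral_le hδ hWs hm hψ.smooth.continuous hψ.compact hper
  set J := ∫ x, φ x * Γ.g x * ψ x with hJ
  have he0 : e 0 = 1 := by simp [he]
  have hnorm : ‖∫ s in (0 : ℝ)..Real.pi, e s * H s‖ = ‖e Real.pi - 1‖ * ‖J‖ := by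
    rw [← norm_mul, sub_mul, one_mul]
    rw [he0, one_mul] at hFTC
    rw [← hFTC, norm_mul]
    simp
  rw [← hswap, hnorm] at hCS
  have hpos : 0 < ‖e Real.pi - 1‖ ^ 2 := by
    have : e Real.pi - 1 ≠ 0 := sub_ne_zero.2 hα
    positivity
  refine le_of_mul_le_mul_left (a := ‖e Real.pi - 1‖ ^ 2) ?_ hpos
  have h1 := mul_le_mul_of_nonneg_left hCS hm0
  have h2 := mul_le_mul_of_nonneg_left hY (integral_nonneg hR0 : 0 ≤ ∫ x, R x)
  rw [mul_pow] at h1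
  change _ ≤ (∫ x, R x) * (‖e Real.pi - 1‖ ^ 2 * ∫ x, Γ.W x * ‖ψ x‖ ^ 2) at h2
  linarith

/-- The pairing estimate for a rotation by multiples of `π`. -/
theorem norm_pairing_sq_le_of_rotation (hδ : Γ.δ = 0) (hc : Γ.c = α)
    (hWs : ∀ s x, Γ.W (Γ.Φ.flow s x) = Γ.W x) {m : ℝ} (hm0 : 0 ≤ m)
    (hm : ∀ q : ℤ, m ≤ |α - 2 * q| ^ 2)
    (hα : Complex.exp (-(Complex.I * α * Real.pi)) ≠ 1)
    (hrot : ∀ x, Γ.Φ.flow Real.pi (Γ.Φ.flow Real.pi x) = x)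
    (hg : ∀ x, Γ.g (Γ.Φ.flow Real.pi x) = Γ.g x)
    {φ : Config N → ℂ} (hφ : MemLp φ 2 volume)
    (hsymm : ∀ᵐ x, φ (Γ.Φ.flow Real.pi x) = φ x)
    {G : Fin N → Config N → EuclideanSpace ℂ (Fin 2)} (hG : ∀ j, MemLp (G j) 2 volume)
    (hD : ∀ j, IsMagneticDeriv α j φ (G j)) {R : Config N → ℝ} (hR0 : ∀ x, 0 ≤ R x)
    (hRi : Integrable R) (hR : ∀ x, ‖derivAlong Γ.Φ.gen G x‖ ^ 2 ≤ Γ.W x * R x)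
    {ψ : Config N → ℂ} (hψ : IsBump Γ.U ψ) :
    m * ‖∫ x, φ x * Γ.g x * ψ x‖ ^ 2 ≤ (∫ x, R x) * ∫ x, Γ.W x * ‖ψ x‖ ^ 2 := by
  have hb := Γ.Φ.isBump_comp_flow Γ.invariant hψ Real.pi
  -- Symmetrising `ψ` leaves the pairing unchanged, because `φ` and `g` are invariant under the half
  -- turn, and does not increase the weighted norm, by convexity.
  set χ : Config N → ℂ := fun x => (1 / 2 : ℂ) * (ψ x + ψ (Γ.Φ.flow Real.pi x)) with hχ
  have hχb : IsBump Γ.U χ := by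
    refine IsBump.mul_left Γ.isOpen (g := fun _ => (1 / 2 : ℂ)) ⟨hψ.smooth.add hb.smooth,
      hψ.compact.add hb.compact, ?_⟩ contDiffOn_const
    refine (tsupport_add ψ (fun x => ψ (Γ.Φ.flow Real.pi x))).trans ?_
    exact Set.union_subset hψ.support hb.support
  have h := Γ.norm_pairing_sq_le_of_rotation_of_invariant hδ hc hWs hm0 hm hα hφ hG hD hR0 hRi hR hχb
    fun x => by simp only [hχ, hrot]; ring
  have hf := Γ.memLp_mul_gauge hφ
  have i1 := integrable_mul_bump hf hψ
  have i2 := integrable_mul_bump hf hb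
  have hdiv := Γ.hasDivergence
  rw [hδ] at hdiv
  have e1 : ∫ x, φ x * Γ.g x * ψ (Γ.Φ.flow Real.pi x) = ∫ x, φ x * Γ.g x * ψ x := by
    have := hdiv.integral_comp (fun x => φ x * Γ.g x * ψ x) Real.pi
    simp only [zero_mul, neg_zero, Real.exp_zero, one_smul] at this
    rw [← this]
    refine integral_congr_ae ?_
    filter_upwards [hsymm] with x hx
    rw [hx, hg]
  have e2 : ∫ x, φ x * Γ.g x * χ x = ∫ x, φ x * Γ.g x * ψ x := by
    have : (fun x => φ x * Γ.g x * χ x) = fun x => (1 / 2 : ℂ) *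
        (φ x * Γ.g x * ψ x + φ x * Γ.g x * ψ (Γ.Φ.flow Real.pi x)) := by
      funext x; simp only [hχ]; ring
    rw [this, integral_const_mul, integral_add i1 i2, e1]
    ring
  rw [e2] at h
  refine h.trans (mul_le_mul_of_nonneg_left ?_ (integral_nonneg hR0))
  have w1 := Γ.integrable_weight_mul_sq hψ.smooth.continuous hψ.compact
  have w2 := Γ.integrable_weight_mul_sq hb.smooth.continuous hb.compact
  have e3 : ∫ x, Γ.W x * ‖ψ (Γ.Φ.flow Real.pi x)‖ ^ 2 = ∫ x, Γ.W x * ‖ψ x‖ ^ 2 := by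
    have := hdiv.integral_comp (fun x => Γ.W x * ‖ψ x‖ ^ 2) Real.pi
    simpa [hWs] using this
  calc ∫ x, Γ.W x * ‖χ x‖ ^ 2 ≤ ∫ x, (1 / 2 : ℝ) * (Γ.W x * ‖ψ x‖ ^ 2 +
        Γ.W x * ‖ψ (Γ.Φ.flow Real.pi x)‖ ^ 2) := by
        refine integral_mono (Γ.integrable_weight_mul_sq hχb.smooth.continuous hχb.compact)
          ((w1.add w2).const_mul _) fun x => ?_
        have h1 : ‖χ x‖ ≤ (1 / 2 : ℝ) * (‖ψ x‖ + ‖ψ (Γ.Φ.flow Real.pi x)‖) := by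
          simp only [hχ, norm_mul]
          norm_num
          exact norm_add_le _ _
        have h2 : ‖χ x‖ ^ 2 ≤ (1 / 2 : ℝ) * (‖ψ x‖ ^ 2 + ‖ψ (Γ.Φ.flow Real.pi x)‖ ^ 2) := by
          refine (pow_le_pow_left₀ (norm_nonneg _) h1 2).trans ?_
          nlinarith [sq_nonneg (‖ψ x‖ - ‖ψ (Γ.Φ.flow Real.pi x)‖)]
        have := mul_le_mul_of_nonneg_left h2 (Γ.weight_nonneg x)
        simp only
        linarith
    _ = _ := by
        rw [integral_const_mul, integral_add w1 w2, e3]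
        ring

end GaugedFlow

variable {N : ℕ}

/-! ### Complex notation for the vector potential -/

section Complex

/-- The identification of the plane with the complex numbers. -/
noncomputable def toC : Plane ≃ₗᵢ[ℝ] ℂ := Complex.orthonormalBasisOneI.repr.symm

theorem toC_apply (v : Plane) : toC v = v 0 + v 1 * Complex.I :=
  Complex.orthonormalBasisOneI_repr_symm_apply v

theorem toC_eq_zero {v : Plane} : toC v = 0 ↔ v = 0 := toC.map_eq_zero_iff

theorem toC_perp (v : Plane) : toC (perp v) = Complex.I * toC v := by
  simp only [toC_apply, perp]
  simp
  linear_combination -(v 1 : ℂ) * Complex.I_sq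

/-- The field `u^⊥ / |u|²` is the gradient of `arg u`, and `Im (v / u)` is the derivative of the
argument in direction `v`. Hence contributions to the potential can be removed by phases built from
arguments. -/
theorem sum_perp_mul (u v : Plane) :
    ∑ a, ((‖u‖ ^ 2)⁻¹ • perp u) a * v a = (toC v / toC u).im := by
  have hn : Complex.normSq (toC u) = ‖u‖ ^ 2 := by
    rw [Complex.normSq_eq_norm_sq, toC.norm_map]
  rw [Complex.div_im, hn]
  simp only [toC_apply, perp, Fin.sum_univ_two]
  simp
  ring

theorem potentialAlong_eq (V : Config N →L[ℝ] Config N) (x : Config N) :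
    potentialAlong V x =
      ∑ i, ∑ k ∈ Finset.univ.erase i, (toC (V x i) / toC (x i - x k)).im := by
  refine Finset.sum_congr rfl fun i _ => ?_
  simp only [vectorPotential, WithLp.ofLp_sum, Finset.sum_apply, Finset.sum_mul]
  rw [Finset.sum_comm]
  exact Finset.sum_congr rfl fun k _ => sum_perp_mul _ _

theorem potentialAlong_of_pair {j l : Fin N} (hjl : j ≠ l) (V : Config N →L[ℝ] Config N)
    (x : Config N) (hV : ∀ i, i ≠ j → i ≠ l → V x i = 0) :
    potentialAlong V x = (toC (V x j) / toC (x j - x l)).im + (toC (V x l) / toC (x l - x j)).im +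
      ∑ k ∈ Finset.univ \ {j, l},
        ((toC (V x j) / toC (x j - x k)).im + (toC (V x l) / toC (x l - x k)).im) := by
  rw [potentialAlong_eq, ← Finset.sum_subset (Finset.subset_univ {j, l})]
  · rw [Finset.sum_pair hjl, Finset.sum_add_distrib]
    have h1 : Finset.univ.erase j = insert l (Finset.univ \ {j, l}) := by
      ext k; simp; grind
    have h2 : Finset.univ.erase l = insert j (Finset.univ \ {j, l}) := by
      ext k; simp; grind
    rw [h1, h2, Finset.sum_insert (by simp), Finset.sum_insert (by simp)]
    ring
  · intro i _ hi
    simp only [Finset.mem_insert, Finset.mem_singleton, not_or] at hi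
    simp [hV i hi.1 hi.2]

theorem norm_sum_mul_le (G : EuclideanSpace ℂ (Fin 2)) (v : Plane) :
    ‖∑ a, G a * (v a : ℂ)‖ ≤ ‖G‖ * ‖v‖ := by
  refine abs_le_of_sq_le_sq' ?_ (by positivity) |>.2
  rw [mul_pow, EuclideanSpace.norm_sq_eq, EuclideanSpace.norm_sq_eq]
  simp only [Fin.sum_univ_two]
  have h1 : ‖G 0 * (v 0 : ℂ) + G 1 * (v 1 : ℂ)‖ ≤ ‖G 0‖ * ‖v 0‖ + ‖G 1‖ * ‖v 1‖ := by
    refine (norm_add_le _ _).trans (le_of_eq ?_)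
    simp
  refine (pow_le_pow_left₀ (norm_nonneg _) h1 2).trans ?_
  nlinarith [sq_nonneg (‖G 0‖ * ‖v 1‖ - ‖G 1‖ * ‖v 0‖)]

theorem norm_derivAlong_sq_le_of_pair {j l : Fin N} (hjl : j ≠ l) (V : Config N →L[ℝ] Config N)
    (G : Fin N → Config N → EuclideanSpace ℂ (Fin 2)) (x : Config N)
    (hV : ∀ i, i ≠ j → i ≠ l → V x i = 0) :
    ‖derivAlong V G x‖ ^ 2 ≤ (‖V x j‖ ^ 2 + ‖V x l‖ ^ 2) * (‖G j x‖ ^ 2 + ‖G l x‖ ^ 2) := by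
  have h1 : derivAlong V G x = (∑ a, G j x a * (V x j a : ℂ)) + ∑ a, G l x a * (V x l a : ℂ) := by
    rw [derivAlong, ← Finset.sum_subset (Finset.subset_univ {j, l}), Finset.sum_pair hjl]
    intro i _ hi
    simp only [Finset.mem_insert, Finset.mem_singleton, not_or] at hi
    simp [hV i hi.1 hi.2]
  have h2 : ‖derivAlong V G x‖ ≤ ‖G j x‖ * ‖V x j‖ + ‖G l x‖ * ‖V x l‖ := by
    rw [h1]
    exact (norm_add_le _ _).trans (add_le_add (norm_sum_mul_le _ _) (norm_sum_mul_le _ _))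
  refine (pow_le_pow_left₀ (norm_nonneg _) h2 2).trans ?_
  nlinarith [sq_nonneg (‖G j x‖ * ‖V x l‖ - ‖G l x‖ * ‖V x j‖)]

end Complex

/-! ### Gauge phases built from principal arguments -/

section Gauge

variable {κ : Type*} (α : ℝ) (S : Finset κ) (u : κ → Config N → ℂ)

/-- The phase factor `exp (i α ∑ arg u_k)`. -/
noncomputable def gaugePhase (x : Config N) : ℂ :=
  Complex.exp (Complex.I * ((α * ∑ k ∈ S, (Complex.log (u k x)).im : ℝ) : ℂ))

theorem norm_gaugePhase (x : Config N) : ‖gaugePhase α S u x‖ = 1 := by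
  rw [gaugePhase, mul_comm]
  exact Complex.norm_exp_ofReal_mul_I _

variable {u}

theorem measurable_gaugePhase (hu : ∀ k, Measurable (u k)) : Measurable (gaugePhase α S u) := by
  unfold gaugePhase
  refine Complex.measurable_exp.comp (measurable_const.mul (Complex.measurable_ofReal.comp
    (measurable_const.mul (Finset.measurable_sum _ fun k _ => ?_))))
  exact Complex.measurable_im.comp (Complex.measurable_log.comp (hu k))

variable {S}

theorem contDiffOn_gaugePhase {U : Set (Config N)} (hu : ∀ k ∈ S, ContDiffOn ℝ ∞ (u k) U)
    (hslit : ∀ k ∈ S, ∀ x ∈ U, u k x ∈ Complex.slitPlane) :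
    ContDiffOn ℝ ∞ (gaugePhase α S u) U := by
  unfold gaugePhase
  refine ContDiffOn.cexp (contDiffOn_const.mul (Complex.ofRealCLM.contDiff.comp_contDiffOn
    (contDiffOn_const.mul (ContDiffOn.sum fun k hk => ?_))))
  have hlog : ContDiffOn ℝ ∞ (fun x => Complex.log (u k x)) U := by
    intro x hx
    have hx' : ContDiffAt ℂ ∞ Complex.log (u k x) := Complex.contDiffAt_log (hslit k hk x hx)
    exact (hx'.restrict_scalars ℝ).comp_contDiffWithinAt x (hu k hk x hx)
  exact Complex.imCLM.contDiff.comp_contDiffOn hlog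

theorem fderiv_gaugePhase {x v : Config N} (hu : ∀ k ∈ S, DifferentiableAt ℝ (u k) x)
    (hslit : ∀ k ∈ S, u k x ∈ Complex.slitPlane) :
    fderiv ℝ (gaugePhase α S u) x v =
      Complex.I * ((α * ∑ k ∈ S, (fderiv ℝ (u k) x v / u k x).im : ℝ) : ℂ) *
        gaugePhase α S u x := by
  have hlog : ∀ k ∈ S, HasFDerivAt (fun y => (Complex.log (u k y)).im)
      (Complex.imCLM.comp ((u k x)⁻¹ • fderiv ℝ (u k) x)) x := fun k hk =>
    Complex.imCLM.hasFDerivAt.comp x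
      ((Complex.hasStrictDerivAt_log (hslit k hk)).hasDerivAt.comp_hasFDerivAt x
        (hu k hk).hasFDerivAt)
  have h1 := (HasFDerivAt.fun_sum hlog).const_mul α
  have h2 := ((Complex.ofRealCLM.hasFDerivAt.comp x h1).const_mul Complex.I).cexp
  have h3 : fderiv ℝ (gaugePhase α S u) x = _ := h2.fderiv
  rw [h3]
  simp only [smul_apply, ContinuousLinearMap.comp_apply,
    sum_apply, smul_eq_mul, Complex.imCLM_apply, Complex.ofRealCLM_apply]
  rw [mul_comm, gaugePhase]
  simp only [div_eq_inv_mul]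
  rfl

end Gauge

/-! ### Rotation and dilation flows from projections -/

section OperatorFlows

variable {E : Type*} [NormedAddCommGroup E] [NormedSpace ℝ E]

/-- The flow of rotations in the range of a projection `P` with complex structure `Q`. -/
noncomputable def rotationFlow (P Q : E →L[ℝ] E) (hPP : ∀ x, P (P x) = P x)
    (hPQ : ∀ x, P (Q x) = Q x) (hQP : ∀ x, Q (P x) = Q x) (hQQ : ∀ x, Q (Q x) = -P x) :
    LinearFlow E where
  flow s := ContinuousLinearMap.id ℝ E + (Real.cos s - 1) • P + Real.sin s • Q
  gen := Q
  flow_zero x := by simp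
  flow_add s t x := by
    simp only [add_apply, smul_apply, ContinuousLinearMap.id_apply, map_add, map_smul, hPP, hPQ,
      hQP, hQQ, Real.cos_add, Real.sin_add]
    module
  hasDerivAt_flow s x := by
    have h1 : HasDerivAt (fun s : ℝ => x + (Real.cos s - 1) • P x + Real.sin s • Q x)
        (-Real.sin s • P x + Real.cos s • Q x) s :=
      ((((Real.hasDerivAt_cos s).sub_const 1).smul_const (P x)).const_add x).add
        ((Real.hasDerivAt_sin s).smul_const (Q x))
    refine h1.congr_deriv ?_
    simp only [add_apply, smul_apply, ContinuousLinearMap.id_apply, map_add, map_smul, hQP, hQQ]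
    module
  continuous_flow := by
    simp only [add_apply, smul_apply, ContinuousLinearMap.id_apply]
    fun_prop

/-- The flow of dilations in the range of a projection `P`. -/
noncomputable def dilationFlow (P : E →L[ℝ] E) (hPP : ∀ x, P (P x) = P x) : LinearFlow E where
  flow s := ContinuousLinearMap.id ℝ E + (Real.exp s - 1) • P
  gen := P
  flow_zero x := by simp
  flow_add s t x := by
    simp only [add_apply, smul_apply, ContinuousLinearMap.id_apply, map_add, map_smul, hPP,
      Real.exp_add]
    module
  hasDerivAt_flow s x := by
    have h1 : HasDerivAt (fun s : ℝ => x + (Real.exp s - 1) • P x) (Real.exp s • P x) s :=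
      (((Real.hasDerivAt_exp s).sub_const 1).smul_const (P x)).const_add x
    refine h1.congr_deriv ?_
    simp only [add_apply, smul_apply, ContinuousLinearMap.id_apply, map_add, map_smul, hPP]
    module
  continuous_flow := by
    simp only [add_apply, smul_apply, ContinuousLinearMap.id_apply]
    fun_prop

end OperatorFlows

/-! ### Derivatives of the gauge factors -/

section GaugeFactor

variable {E : Type*} [NormedAddCommGroup E] [NormedSpace ℝ E] (Z W : E →L[ℝ] ℂ) (n : ℕ)

theorem contDiffAt_gaugeFactor {x : E} (hW : W x ≠ 0) :
    ContDiffAt ℝ ∞ (fun y => 1 - (Z y / W y) ^ n) x := by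
  simp only [div_eq_mul_inv]
  exact contDiffAt_const.sub ((Z.contDiff.contDiffAt.mul (W.contDiff.contDiffAt.inv hW)).pow n)

/-- The direction `v` leaves the denominator fixed, so only `Z` varies. Rotations use `n = 2` and
dilations `n = 1`. -/
theorem fderiv_gaugeFactor {x v : E} (hW : W x ≠ 0) (hv : W v = 0) :
    fderiv ℝ (fun y => 1 - (Z y / W y) ^ n) x v =
      -(n * (Z x / W x) ^ (n - 1) * (Z v / W x)) := by
  have hd := (contDiffAt_gaugeFactor Z W n hW).differentiableAt (by simp)
  have hline : HasDerivAt (fun t : ℝ => x + t • v) v 0 := by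
    simpa using ((hasDerivAt_id (0 : ℝ)).smul_const v).const_add x
  have hd' : HasFDerivAt (fun y => 1 - (Z y / W y) ^ n)
      (fderiv ℝ (fun y => 1 - (Z y / W y) ^ n) x) (x + (0 : ℝ) • v) := by
    simpa using hd.hasFDerivAt
  have h1 := hd'.comp_hasDerivAt (0 : ℝ) hline
  have h2 : HasDerivAt (fun t : ℝ => 1 - ((Z x + t * Z v) / W x) ^ n)
      (-(n * (Z x / W x) ^ (n - 1) * (Z v / W x))) 0 := by
    have h3 : HasDerivAt (fun t : ℝ => (Z x + t * Z v) / W x) (Z v / W x) 0 := by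
      have := (((hasDerivAt_id (0 : ℝ)).ofReal_comp.mul_const (Z v)).const_add (Z x)).div_const (W x)
      simpa using this
    simpa using (h3.pow n).const_sub 1
  refine h1.unique ?_
  convert! h2 using 1
  funext t
  simp [hv, Complex.real_smul]

end GaugeFactor

/-! ### Rotation of a pair about its midpoint -/

section PairRotation

/-- The rotation by `π/2` of the plane as a linear map. -/
noncomputable def perpCLM : Plane →L[ℝ] Plane :=
  LinearMap.toContinuousLinearMap
    { toFun := perp
      map_add' := fun u v => by ext a; fin_cases a <;> simp [perp]; ring
      map_smul' := fun c v => by ext a; fin_cases a <;> simp [perp] }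

theorem perpCLM_apply (v : Plane) : perpCLM v = perp v := rfl

theorem perp_perp (v : Plane) : perp (perp v) = -v := by
  ext a; fin_cases a <;> simp [perp]

theorem norm_perp (v : Plane) : ‖perp v‖ = ‖v‖ := by
  rw [← toC.norm_map, toC_perp, norm_mul, Complex.norm_I, one_mul, toC.norm_map]

theorem norm_rotate (s : ℝ) (v : Plane) : ‖Real.cos s • v + Real.sin s • perp v‖ = ‖v‖ := by
  rw [← toC.norm_map, map_add, map_smul, map_smul, toC_perp]
  have : Real.cos s • toC v + Real.sin s • (Complex.I * toC v) =
      Complex.exp (s * Complex.I) * toC v := by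
    rw [Complex.exp_mul_I, Complex.real_smul, Complex.real_smul]
    push_cast
    ring
  rw [this, norm_mul, Complex.norm_exp_ofReal_mul_I, one_mul, toC.norm_map]

/-- The position of a particle. -/
noncomputable def coord (j : Fin N) : Config N →L[ℝ] Plane :=
  ContinuousLinearMap.proj (R := ℝ) (φ := fun _ : Fin N => Plane) j

/-- Half of the relative position of two particles. -/
noncomputable def halfDiff (j l : Fin N) : Config N →L[ℝ] Plane :=
  (1 / 2 : ℝ) • (coord j - coord l)

/-- The midpoint of two particles. -/
noncomputable def midpt (j l : Fin N) : Config N →L[ℝ] Plane :=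
  (1 / 2 : ℝ) • (coord j + coord l)

/-- Opposite displacements of two particles. -/
noncomputable def spread (j l : Fin N) : Plane →L[ℝ] Config N :=
  ContinuousLinearMap.pi fun i =>
    (if i = j then (1 : ℝ) else if i = l then -1 else 0) • ContinuousLinearMap.id ℝ Plane

theorem halfDiff_apply (j l : Fin N) (x : Config N) :
    halfDiff j l x = (1 / 2 : ℝ) • (x j - x l) := rfl

theorem midpt_apply (j l : Fin N) (x : Config N) :
    midpt j l x = (1 / 2 : ℝ) • (x j + x l) := rfl

theorem spread_apply (j l : Fin N) (v : Plane) (i : Fin N) :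
    spread j l v i = (if i = j then (1 : ℝ) else if i = l then -1 else 0) • v := rfl

variable {j l : Fin N}

theorem spread_left (v : Plane) : spread j l v j = v := by simp [spread_apply]

theorem spread_right (hjl : j ≠ l) (v : Plane) : spread j l v l = -v := by
  simp [spread_apply, hjl.symm]

theorem spread_other {i : Fin N} (hj : i ≠ j) (hl : i ≠ l) (v : Plane) : spread j l v i = 0 := by
  simp [spread_apply, hj, hl]

theorem halfDiff_spread (hjl : j ≠ l) (v : Plane) : halfDiff j l (spread j l v) = v := by
  rw [halfDiff_apply, spread_left, spread_right hjl]
  module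

theorem midpt_spread (hjl : j ≠ l) (v : Plane) : midpt j l (spread j l v) = 0 := by
  rw [midpt_apply, spread_left, spread_right hjl]
  module

/-- The rotation of two particles about their midpoint. -/
noncomputable def pairRotation (hjl : j ≠ l) : LinearFlow (Config N) :=
  rotationFlow (spread j l ∘L halfDiff j l) (spread j l ∘L perpCLM ∘L halfDiff j l)
    (fun x => by simp [halfDiff_spread hjl])
    (fun x => by simp [halfDiff_spread hjl])
    (fun x => by simp [halfDiff_spread hjl])
    (fun x => by simp [halfDiff_spread hjl, perpCLM_apply, perp_perp])

theorem pairRotation_gen (hjl : j ≠ l) (x : Config N) :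
    (pairRotation hjl).gen x = spread j l (perp (halfDiff j l x)) := rfl

theorem pairRotation_flow (hjl : j ≠ l) (s : ℝ) (x : Config N) :
    (pairRotation hjl).flow s x = x + (Real.cos s - 1) • spread j l (halfDiff j l x) +
      Real.sin s • spread j l (perp (halfDiff j l x)) := rfl

theorem pairRotation_flow_other (hjl : j ≠ l) (s : ℝ) (x : Config N) {i : Fin N} (hj : i ≠ j)
    (hl : i ≠ l) : (pairRotation hjl).flow s x i = x i := by
  simp [pairRotation_flow, spread_other hj hl]

theorem halfDiff_pairRotation (hjl : j ≠ l) (s : ℝ) (x : Config N) :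
    halfDiff j l ((pairRotation hjl).flow s x) =
      Real.cos s • halfDiff j l x + Real.sin s • perp (halfDiff j l x) := by
  simp only [pairRotation_flow, map_add, map_smul, halfDiff_spread hjl]
  module

theorem midpt_pairRotation (hjl : j ≠ l) (s : ℝ) (x : Config N) :
    midpt j l ((pairRotation hjl).flow s x) = midpt j l x := by
  simp only [pairRotation_flow, map_add, map_smul, midpt_spread hjl]
  simp

theorem norm_halfDiff_pairRotation (hjl : j ≠ l) (s : ℝ) (x : Config N) :
    ‖halfDiff j l ((pairRotation hjl).flow s x)‖ = ‖halfDiff j l x‖ := by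
  rw [halfDiff_pairRotation, norm_rotate]

theorem norm_halfDiff (x : Config N) : ‖halfDiff j l x‖ = ‖x j - x l‖ / 2 := by
  rw [halfDiff_apply, norm_smul]
  norm_num
  ring

/-- This is where the symmetry of `φ` enters: the period along orbits is `π` instead of `2π`, which
leaves only even modes. -/
theorem pairRotation_pi (hjl : j ≠ l) (x : Config N) :
    (pairRotation hjl).flow Real.pi x = x ∘ Equiv.swap j l := by
  funext i
  simp only [pairRotation_flow, Real.cos_pi, Real.sin_pi, zero_smul, Pi.add_apply,
    Pi.smul_apply, Pi.zero_apply, add_zero, Function.comp_apply]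
  by_cases hj : i = j
  · subst hj
    rw [spread_left, Equiv.swap_apply_left, halfDiff_apply]
    module
  by_cases hl : i = l
  · subst hl
    rw [spread_right hjl, Equiv.swap_apply_right, halfDiff_apply]
    module
  · rw [spread_other hj hl, Equiv.swap_apply_of_ne_of_ne hj hl]
    simp

theorem divergence_pairRotation (hjl : j ≠ l) : divergence (pairRotation hjl).gen = 0 := by
  refine Finset.sum_eq_zero fun i _ => Finset.sum_eq_zero fun a _ => ?_
  rw [pairRotation_gen, spread_apply, halfDiff_apply]
  have key : ∀ c : ℝ, perp ((1 / 2 : ℝ) • (c • EuclideanSpace.single a (1 : ℝ))) a = 0 := by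
    intro c
    fin_cases a <;> simp [perp]
  have h2 : ∀ k : Fin N, (Pi.single i (EuclideanSpace.single a (1 : ℝ)) : Config N) k =
      (if k = i then (1 : ℝ) else 0) • EuclideanSpace.single a (1 : ℝ) := by
    intro k
    by_cases hk : k = i
    · subst hk; simp
    · simp [hk]
  rw [h2, h2, ← sub_smul]
  simp only [PiLp.smul_apply, key, smul_zero]

/-- The configurations without coincidences in which no other particle lies in the closed disc
whose diameter is the segment between the particles `j` and `l`. -/
def emptyDisc (j l : Fin N) : Set (Config N) :=
  {x | x ∉ diagonals N ∧ ∀ k, k ≠ j → k ≠ l → ‖halfDiff j l x‖ < ‖x k - midpt j l x‖}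

theorem isOpen_emptyDisc : IsOpen (emptyDisc j l) := by
  have : emptyDisc j l = (diagonals N)ᶜ ∩ ⋂ k : Fin N, {x | k ≠ j → k ≠ l →
      ‖halfDiff j l x‖ < ‖x k - midpt j l x‖} := by
    ext x; simp [emptyDisc]
  rw [this]
  refine isOpen_compl_diagonals.inter (isOpen_iInter_of_finite fun k => ?_)
  by_cases hj : k = j
  · simp [hj]
  by_cases hl : k = l
  · simp [hl]
  simp only [ne_eq, hj, hl, not_false_eq_true, forall_const]
  exact isOpen_lt (by fun_prop) (by fun_prop)

theorem eq_midpt_add (x : Config N) : x j = midpt j l x + halfDiff j l x := by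
  rw [midpt_apply, halfDiff_apply]; module

theorem eq_midpt_sub (x : Config N) : x l = midpt j l x - halfDiff j l x := by
  rw [midpt_apply, halfDiff_apply]; module

/-- The pair moves on the boundary circle of its disc, while the other particles stay fixed outside
the closed disc, so no collision can occur. -/
theorem pairRotation_mem_emptyDisc (hjl : j ≠ l) (s : ℝ) {x : Config N} (hx : x ∈ emptyDisc j l) :
    (pairRotation hjl).flow s x ∈ emptyDisc j l := by
  set y := (pairRotation hjl).flow s x with hy
  have hk : ∀ k, k ≠ j → k ≠ l → ‖halfDiff j l y‖ < ‖y k - midpt j l y‖ := by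
    intro k hj hl
    rw [hy, norm_halfDiff_pairRotation, midpt_pairRotation, pairRotation_flow_other hjl s x hj hl]
    exact hx.2 k hj hl
  refine ⟨?_, hk⟩
  have hyj : ∀ k, k ≠ j → k ≠ l → y k ≠ y j := by
    intro k hj hl h
    have := hk k hj hl
    rw [h, eq_midpt_add (j := j) (l := l) y, add_sub_cancel_left] at this
    exact lt_irrefl _ this
  have hyl : ∀ k, k ≠ j → k ≠ l → y k ≠ y l := by
    intro k hj hl h
    have := hk k hj hl
    rw [h, eq_midpt_sub (j := j) (l := l) y, sub_sub_cancel_left, norm_neg] at this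
    exact lt_irrefl _ this
  have hyjl : y j ≠ y l := by
    intro h
    have h1 : ‖halfDiff j l y‖ = 0 := by simp [halfDiff_apply, h]
    rw [hy, norm_halfDiff_pairRotation, norm_halfDiff] at h1
    refine hx.1 ⟨j, l, hjl, ?_⟩
    have h2 : ‖x j - x l‖ = 0 := by linarith
    exact sub_eq_zero.1 (norm_eq_zero.1 h2)
  rintro ⟨p, q, hpq, h⟩
  by_cases hpj : p = j
  · subst hpj
    by_cases hql : q = l
    · subst hql; exact hyjl h
    · exact hyj q hpq.symm hql h.symm
  by_cases hpl : p = l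
  · subst hpl
    by_cases hqj : q = j
    · subst hqj; exact hyjl h.symm
    · exact hyl q hqj hpq.symm h.symm
  by_cases hqj : q = j
  · subst hqj; exact hyj p hpj hpl h
  by_cases hql : q = l
  · subst hql; exact hyl p hpj hpl h
  · rw [hy, pairRotation_flow_other hjl s x hpj hpl, pairRotation_flow_other hjl s x hqj hql] at h
    exact hx.1 ⟨p, q, hpq, h⟩

/-- The half difference as a complex number. -/
noncomputable def halfDiffC (j l : Fin N) : Config N →L[ℝ] ℂ :=
  (toC : Plane →L[ℝ] ℂ) ∘L halfDiff j l

/-- The position of a particle relative to the midpoint of two others, as a complex number. -/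
noncomputable def fromMidptC (j l k : Fin N) : Config N →L[ℝ] ℂ :=
  (toC : Plane →L[ℝ] ℂ) ∘L (coord k - midpt j l)

theorem halfDiffC_apply (x : Config N) : halfDiffC j l x = toC (halfDiff j l x) := rfl

theorem fromMidptC_apply (k : Fin N) (x : Config N) :
    fromMidptC j l k x = toC (x k - midpt j l x) := rfl

/-- The factors whose arguments make up the gauge transformation for the rotation of a pair. -/
noncomputable def rotationFactor (j l k : Fin N) (x : Config N) : ℂ :=
  1 - (halfDiffC j l x / fromMidptC j l k x) ^ 2

theorem fromMidptC_ne_zero {k : Fin N} {x : Config N} (hx : x ∈ emptyDisc j l) (hj : k ≠ j)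
    (hl : k ≠ l) : fromMidptC j l k x ≠ 0 := by
  rw [fromMidptC_apply, Ne, toC_eq_zero, ← norm_eq_zero]
  exact ((norm_nonneg _).trans_lt (hx.2 k hj hl)).ne'

theorem norm_halfDiffC_div_lt {k : Fin N} {x : Config N} (hx : x ∈ emptyDisc j l) (hj : k ≠ j)
    (hl : k ≠ l) : ‖halfDiffC j l x / fromMidptC j l k x‖ < 1 := by
  rw [norm_div, div_lt_one (norm_pos_iff.2 (fromMidptC_ne_zero hx hj hl)), halfDiffC_apply,
    fromMidptC_apply, toC.norm_map, toC.norm_map]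
  exact hx.2 k hj hl

/-- With half difference `z` and `w` the position of `k` from the midpoint, the factor is `1 -
(z/w)²`. Emptiness of the disc means `|z| < |w|`, so it lies within distance one of `1`: particle
`k` contributes no winding. -/
theorem rotationFactor_mem_slitPlane {k : Fin N} {x : Config N} (hx : x ∈ emptyDisc j l)
    (hj : k ≠ j) (hl : k ≠ l) : rotationFactor j l k x ∈ Complex.slitPlane := by
  rw [rotationFactor, sub_eq_add_neg]
  refine Complex.mem_slitPlane_of_norm_lt_one ?_
  rw [norm_neg, norm_pow]
  exact pow_lt_one₀ (norm_nonneg _) (norm_halfDiffC_div_lt hx hj hl) (by norm_num)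

/-- Each member of the pair contributes `Im (i/2)` through the other, in total `1`. For another
particle `k`, `(x_j - x_k)(x_l - x_k) = w² - z²` is the rotation factor times the fixed number `w²`,
so the two contributions add up to the derivative of its argument. -/
theorem potentialAlong_pairRotation (hjl : j ≠ l) {x : Config N} (hx : x ∈ emptyDisc j l) :
    potentialAlong (pairRotation hjl).gen x = 1 + ∑ k ∈ Finset.univ \ {j, l},
      (fderiv ℝ (rotationFactor j l k) x ((pairRotation hjl).gen x) / rotationFactor j l k x).im := by
  rw [potentialAlong_of_pair hjl _ _ fun i hj hl => by rw [pairRotation_gen, spread_other hj hl]]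
  have hz : halfDiffC j l x ≠ 0 := by
    rw [halfDiffC_apply, Ne, toC_eq_zero, ← norm_eq_zero, norm_halfDiff]
    have : x j ≠ x l := fun h => hx.1 ⟨j, l, hjl, h⟩
    have := norm_pos_iff.2 (sub_ne_zero.2 this)
    positivity
  have e1 : toC ((pairRotation hjl).gen x j) = Complex.I * halfDiffC j l x := by
    rw [pairRotation_gen, spread_left, toC_perp, halfDiffC_apply]
  have e2 : toC ((pairRotation hjl).gen x l) = -(Complex.I * halfDiffC j l x) := by
    rw [pairRotation_gen, spread_right hjl, map_neg, toC_perp, halfDiffC_apply]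
  have e3 : toC (x j - x l) = 2 * halfDiffC j l x := by
    rw [halfDiffC_apply, halfDiff_apply, map_smul, Complex.real_smul]
    push_cast; ring
  have e4 : toC (x l - x j) = -(2 * halfDiffC j l x) := by
    rw [← e3, ← map_neg, neg_sub]
  rw [e1, e2, e3, e4]
  congr 1
  · have h1 : Complex.I * halfDiffC j l x / (2 * halfDiffC j l x) = Complex.I / 2 := by
      field_simp
    rw [neg_div_neg_eq, h1]
    norm_num
  · refine Finset.sum_congr rfl fun k hk => ?_
    have hk' : k ≠ j ∧ k ≠ l := by simpa using hk
    have hw := fromMidptC_ne_zero hx hk'.1 hk'.2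
    have hlt := norm_halfDiffC_div_lt hx hk'.1 hk'.2
    have e5 : toC (x j - x k) = halfDiffC j l x - fromMidptC j l k x := by
      rw [halfDiffC_apply, fromMidptC_apply, ← map_sub]
      congr 1
      conv_lhs => rw [eq_midpt_add (j := j) (l := l) x]
      abel
    have e6 : toC (x l - x k) = -(halfDiffC j l x + fromMidptC j l k x) := by
      rw [halfDiffC_apply, fromMidptC_apply, ← map_add, ← map_neg]
      congr 1
      conv_lhs => rw [eq_midpt_sub (j := j) (l := l) x]
      abel
    have hgen : fromMidptC j l k ((pairRotation hjl).gen x) = 0 := by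
      rw [fromMidptC_apply, pairRotation_gen, midpt_spread hjl, spread_other hk'.1 hk'.2]
      simp
    have hgen' : halfDiffC j l ((pairRotation hjl).gen x) = Complex.I * halfDiffC j l x := by
      rw [halfDiffC_apply, pairRotation_gen, halfDiff_spread hjl, toC_perp, halfDiffC_apply]
    have hder : fderiv ℝ (rotationFactor j l k) x ((pairRotation hjl).gen x) = _ :=
      fderiv_gaugeFactor (halfDiffC j l) (fromMidptC j l k) 2 hw hgen
    rw [hder, e5, e6, hgen', ← Complex.add_im, rotationFactor]
    congr 1
    set z := halfDiffC j l x
    set w := fromMidptC j l k x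
    have h1 : z - w ≠ 0 := by
      intro h
      rw [sub_eq_zero.1 h, div_self hw] at hlt
      simp at hlt
    have h2 : z + w ≠ 0 := by
      intro h
      rw [eq_neg_of_add_eq_zero_left h, neg_div, div_self hw] at hlt
      simp at hlt
    have h3 : 1 - (z / w) ^ 2 ≠ 0 := by
      intro h
      have h4 : (z - w) * (z + w) = 0 := by
        field_simp at h
        linear_combination -h
      exact (mul_ne_zero h1 h2) h4
    have h5 : w ^ 2 - z ^ 2 ≠ 0 := by
      intro h
      exact (mul_ne_zero h1 h2) (by linear_combination -h)
    rw [neg_div_neg_eq]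
    have h6 : 1 - (z / w) ^ 2 = (w ^ 2 - z ^ 2) / w ^ 2 := by field_simp
    rw [h6, show (2 - 1 : ℕ) = 1 from rfl, pow_one]
    field_simp
    push_cast
    ring

/-- The rotation of two particles about their midpoint, on the region where no other particle
is in the disc between them. -/
noncomputable def rotationGaugedFlow (α : ℝ) (hjl : j ≠ l) : GaugedFlow N α where
  Φ := pairRotation hjl
  δ := 0
  divergence_eq := divergence_pairRotation hjl
  U := emptyDisc j l
  isOpen := isOpen_emptyDisc
  subset := fun x hx => hx.1
  invariant := fun s x hx => pairRotation_mem_emptyDisc hjl s hx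
  g := gaugePhase α (Finset.univ \ {j, l}) (rotationFactor j l)
  measurable := measurable_gaugePhase α _ fun k => by
    unfold rotationFactor
    fun_prop
  norm_eq_one := norm_gaugePhase α _ _
  contDiffOn := by
    refine contDiffOn_gaugePhase α (fun k hk x hx => ?_) fun k hk x hx => ?_
    · have hk' : k ≠ j ∧ k ≠ l := by simpa using hk
      exact (contDiffAt_gaugeFactor _ _ 2
        (fromMidptC_ne_zero hx hk'.1 hk'.2)).contDiffWithinAt
    · have hk' : k ≠ j ∧ k ≠ l := by simpa using hk
      exact rotationFactor_mem_slitPlane hx hk'.1 hk'.2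
  c := α
  gauge := by
    intro x hx
    rw [fderiv_gaugePhase α, potentialAlong_pairRotation hjl hx]
    · push_cast
      linear_combination (α * (∑ k ∈ Finset.univ \ {j, l},
        ((fderiv ℝ (rotationFactor j l k) x ((pairRotation hjl).gen x) /
          rotationFactor j l k x).im : ℂ)) *
        gaugePhase α (Finset.univ \ {j, l}) (rotationFactor j l) x) * Complex.I_sq
    · intro k hk
      have hk' : k ≠ j ∧ k ≠ l := by simpa using hk
      exact (contDiffAt_gaugeFactor _ _ 2
        (fromMidptC_ne_zero hx hk'.1 hk'.2)).differentiableAt (by simp)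
    · intro k hk
      have hk' : k ≠ j ∧ k ≠ l := by simpa using hk
      exact rotationFactor_mem_slitPlane hx hk'.1 hk'.2
  W := fun x => ‖x j - x l‖ ^ 2
  contDiff_weight := ContDiff.norm_sq ℝ (by fun_prop)
  weight_nonneg := fun x => by positivity
  weight_pos := fun x hx => by
    have : x j - x l ≠ 0 := sub_ne_zero.2 fun h => hx.1 ⟨j, l, hjl, h⟩
    positivity

theorem setLIntegral_emptyDisc_le (hjl : j ≠ l) {α m : ℝ} (hm0 : 0 < m)
    (hm : ∀ q : ℤ, m ≤ |α - 2 * q| ^ 2)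
    (hα : Complex.exp (-(Complex.I * α * Real.pi)) ≠ 1) {φ : Config N → ℂ} (hφ : IsSymmetricL2 φ)
    {G : Fin N → Config N → EuclideanSpace ℂ (Fin 2)} (hG : ∀ j, MemLp (G j) 2 volume)
    (hD : ∀ j, IsMagneticDeriv α j φ (G j)) :
    ∫⁻ x in emptyDisc j l, ENNReal.ofReal (‖φ x‖ ^ 2 / ‖x j - x l‖ ^ 2) ≤
      ENNReal.ofReal ((2 * m)⁻¹ * ((∫ x, ‖G j x‖ ^ 2) + ∫ x, ‖G l x‖ ^ 2)) := by
  set Γ := rotationGaugedFlow α hjl with hΓ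
  have hi : ∀ i, Integrable fun x => ‖G i x‖ ^ 2 := fun i =>
    (memLp_two_iff_integrable_sq_norm (hG i).1).1 (hG i)
  have hi0 : ∀ i, 0 ≤ ∫ x, ‖G i x‖ ^ 2 := fun i => integral_nonneg fun x => by positivity
  have hM : 0 ≤ (2 * m)⁻¹ * ((∫ x, ‖G j x‖ ^ 2) + ∫ x, ‖G l x‖ ^ 2) := by
    have := hi0 j
    have := hi0 l
    positivity
  have h := setLIntegral_sq_div_le_of_pairing_le volume Γ.isOpen (Γ.memLp_mul_gauge hφ.memLp)
    Γ.contDiff_weight Γ.weight_pos hM fun ψ hψ => ?_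
  · simpa [Γ.norm_eq_one] using! h
  -- Both displacements have length `‖x j - x l‖ / 2`, so their squares sum to half the weight. This
  -- is the factor `1/2` in `R` and the `2` in `(2 * m)⁻¹`.
  have hR : ∀ x, ‖derivAlong Γ.Φ.gen G x‖ ^ 2 ≤
      Γ.W x * ((1 / 2 : ℝ) * (‖G j x‖ ^ 2 + ‖G l x‖ ^ 2)) := by
    intro x
    have h1 := norm_derivAlong_sq_le_of_pair hjl (pairRotation hjl).gen G x
      fun i hj hl => by rw [pairRotation_gen, spread_other hj hl]
    refine h1.trans (le_of_eq ?_)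
    rw [pairRotation_gen, spread_left, spread_right hjl, norm_neg, norm_perp, norm_halfDiff]
    change _ = ‖x j - x l‖ ^ 2 * _
    ring
  have key := Γ.norm_pairing_sq_le_of_rotation rfl rfl (fun s x => ?_) hm0.le hm hα (fun x => ?_)
    (fun x => ?_) hφ.memLp ?_ hG hD (R := fun x => (1 / 2 : ℝ) * (‖G j x‖ ^ 2 + ‖G l x‖ ^ 2))
    (fun x => by positivity) (((hi j).add (hi l)).const_mul (1 / 2 : ℝ)) hR hψ
  · rw [integral_const_mul, integral_add (hi j) (hi l)] at key
    rw [mul_inv, mul_assoc, mul_assoc, mul_comm (2⁻¹ : ℝ), mul_assoc, inv_mul_eq_div,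
      le_div_iff₀ hm0]
    linarith
  · change ‖(pairRotation hjl).flow s x j - (pairRotation hjl).flow s x l‖ ^ 2 = ‖x j - x l‖ ^ 2
    have := norm_halfDiff_pairRotation hjl s x
    rw [norm_halfDiff, norm_halfDiff] at this
    rw [show ‖(pairRotation hjl).flow s x j - (pairRotation hjl).flow s x l‖ = ‖x j - x l‖ by
      linarith]
  · change (pairRotation hjl).flow Real.pi ((pairRotation hjl).flow Real.pi x) = x
    rw [pairRotation_pi, pairRotation_pi]
    funext i
    simp
  · change gaugePhase α _ (rotationFactor j l) ((pairRotation hjl).flow Real.pi x) =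
      gaugePhase α _ (rotationFactor j l) x
    unfold gaugePhase
    congr 3
    refine congrArg _ (Finset.sum_congr rfl fun k hk => ?_)
    have hk' : k ≠ j ∧ k ≠ l := by simpa using hk
    -- The half turn only changes the sign of the half difference, and the factor is even in it.
    have h1 : rotationFactor j l k ((pairRotation hjl).flow Real.pi x) = rotationFactor j l k x := by
      rw [rotationFactor, rotationFactor, halfDiffC_apply, fromMidptC_apply, halfDiff_pairRotation,
        midpt_pairRotation, pairRotation_flow_other hjl _ x hk'.1 hk'.2]
      simp [halfDiffC_apply, fromMidptC_apply, neg_div]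
    rw [h1]
  · filter_upwards [hφ.symm (Equiv.swap j l)] with x hx
    change φ ((pairRotation hjl).flow Real.pi x) = φ x
    rw [pairRotation_pi]
    exact hx

end PairRotation

/-! ### Dilation of a pair about a third particle -/

section Dilation

/-- The displacements of two particles from a third one. -/
noncomputable def pairFrom (j l k : Fin N) : Config N →L[ℝ] Config N :=
  ContinuousLinearMap.pi fun i => if i = j ∨ i = l then coord i - coord k else 0

theorem pairFrom_apply (j l k : Fin N) (x : Config N) (i : Fin N) :
    pairFrom j l k x i = if i = j ∨ i = l then x i - x k else 0 := by
  simp only [pairFrom, ContinuousLinearMap.coe_pi']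
  split_ifs <;> rfl

variable {j l k : Fin N}

theorem pairFrom_of_mem {i : Fin N} (hi : i = j ∨ i = l) (x : Config N) :
    pairFrom j l k x i = x i - x k := by rw [pairFrom_apply, if_pos hi]

theorem pairFrom_of_notMem {i : Fin N} (hi : ¬(i = j ∨ i = l)) (x : Config N) :
    pairFrom j l k x i = 0 := by rw [pairFrom_apply, if_neg hi]

/-- The dilation of two particles with a third one as centre. -/
noncomputable def pairDilation (hkj : k ≠ j) (hkl : k ≠ l) : LinearFlow (Config N) :=
  dilationFlow (pairFrom j l k) fun x => by
    funext i
    have hk : ¬(k = j ∨ k = l) := by tauto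
    by_cases hi : i = j ∨ i = l
    · rw [pairFrom_of_mem hi, pairFrom_of_mem hi, pairFrom_of_notMem hk, sub_zero]
    · rw [pairFrom_of_notMem hi, pairFrom_of_notMem hi]

theorem pairDilation_gen (hkj : k ≠ j) (hkl : k ≠ l) (x : Config N) :
    (pairDilation hkj hkl).gen x = pairFrom j l k x := rfl

theorem pairDilation_flow_of_notMem (hkj : k ≠ j) (hkl : k ≠ l) (s : ℝ) (x : Config N) {i : Fin N}
    (hi : ¬(i = j ∨ i = l)) : (pairDilation hkj hkl).flow s x i = x i := by
  change x i + (Real.exp s - 1) • pairFrom j l k x i = x i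
  rw [pairFrom_of_notMem hi, smul_zero, add_zero]

theorem pairDilation_flow_of_mem (hkj : k ≠ j) (hkl : k ≠ l) (s : ℝ) (x : Config N) {i : Fin N}
    (hi : i = j ∨ i = l) :
    (pairDilation hkj hkl).flow s x i = x k + Real.exp s • (x i - x k) := by
  change x i + (Real.exp s - 1) • pairFrom j l k x i = _
  rw [pairFrom_of_mem hi]
  module

theorem pairDilation_flow_sub (hkj : k ≠ j) (hkl : k ≠ l) (s : ℝ) (x : Config N) {i : Fin N}
    (hi : i = j ∨ i = l) :
    (pairDilation hkj hkl).flow s x i - (pairDilation hkj hkl).flow s x k =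
      Real.exp s • (x i - x k) := by
  rw [pairDilation_flow_of_mem hkj hkl s x hi, pairDilation_flow_of_notMem hkj hkl s x (by tauto)]
  module

theorem divergence_pairDilation (hjl : j ≠ l) (hkj : k ≠ j) (hkl : k ≠ l) :
    divergence (pairDilation hkj hkl).gen = 4 := by
  have h : ∀ i : Fin N, ∑ a, (pairDilation hkj hkl).gen
      (Pi.single i (EuclideanSpace.single a 1)) i a = if i = j ∨ i = l then (2 : ℝ) else 0 := by
    intro i
    simp only [pairDilation_gen, pairFrom_apply]
    split_ifs with hi
    · have hki : k ≠ i := by rintro rfl; tauto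
      simp [hki]
    · simp
  rw [divergence]
  simp_rw [h]
  rw [← Finset.sum_filter, Finset.filter_or, Finset.sum_union]
  · simp [Finset.filter_eq']
    norm_num
  · simp [Finset.filter_eq', hjl]

/-- The displacement of particle `i` from particle `k` as a complex number. -/
noncomputable def diffC (k i : Fin N) : Config N →L[ℝ] ℂ :=
  (toC : Plane →L[ℝ] ℂ) ∘L (coord i - coord k)

theorem diffC_apply (i : Fin N) (x : Config N) : diffC k i x = toC (x i - x k) := rfl

/-- Twice the oriented area of the triangle of particles `k`, `m`, `i`. -/
noncomputable def area (k i m : Fin N) (x : Config N) : ℝ :=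
  (diffC k i x * (starRingEnd ℂ) (diffC k m x)).im

/-- The configurations without coincidences in which neither `j` nor `l` is collinear with `k` and
a fourth particle. -/
def generic (j l k : Fin N) : Set (Config N) :=
  {x | x ∉ diagonals N ∧ ∀ i, (i = j ∨ i = l) → ∀ m, ¬(m = j ∨ m = l) → m ≠ k →
    area k i m x ≠ 0}

theorem continuous_area (i m : Fin N) : Continuous (area k i m) := by
  unfold area
  fun_prop

theorem isOpen_generic : IsOpen (generic j l k) := by
  have : generic j l k = (diagonals N)ᶜ ∩ ⋂ i : Fin N, ⋂ m : Fin N,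
      {x | (i = j ∨ i = l) → ¬(m = j ∨ m = l) → m ≠ k → area k i m x ≠ 0} := by
    ext x
    simp only [generic, Set.mem_ofPred_eq, Set.mem_inter_iff, Set.mem_compl_iff, Set.mem_iInter]
    exact and_congr_right fun _ => ⟨fun h i m hi hm hk => h i hi m hm hk,
      fun h i hi m hm hk => h i m hi hm hk⟩
  rw [this]
  refine isOpen_compl_diagonals.inter (isOpen_iInter_of_finite fun i =>
    isOpen_iInter_of_finite fun m => ?_)
  by_cases h : (i = j ∨ i = l) ∧ ¬(m = j ∨ m = l) ∧ m ≠ k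
  · have : {x : Config N | (i = j ∨ i = l) → ¬(m = j ∨ m = l) → m ≠ k → area k i m x ≠ 0} =
        {x | area k i m x ≠ 0} := by
      ext x; simp only [Set.mem_ofPred_eq]; tauto
    rw [this]
    exact isOpen_ne_fun (continuous_area i m) continuous_const
  · have : {x : Config N | (i = j ∨ i = l) → ¬(m = j ∨ m = l) → m ≠ k → area k i m x ≠ 0} =
        Set.univ := by
      ext x; simp only [Set.mem_ofPred_eq, Set.mem_univ]; tauto
    rw [this]
    exact isOpen_univ

theorem area_pairDilation (hkj : k ≠ j) (hkl : k ≠ l) (s : ℝ) (x : Config N) {i m : Fin N}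
    (hi : i = j ∨ i = l) (hm : ¬(m = j ∨ m = l)) :
    area k i m ((pairDilation hkj hkl).flow s x) = Real.exp s * area k i m x := by
  have h1 : diffC k i ((pairDilation hkj hkl).flow s x) = Real.exp s * diffC k i x := by
    rw [diffC_apply, pairDilation_flow_sub hkj hkl s x hi, map_smul, Complex.real_smul, diffC_apply]
  have h2 : diffC k m ((pairDilation hkj hkl).flow s x) = diffC k m x := by
    rw [diffC_apply, pairDilation_flow_of_notMem hkj hkl s x hm,
      pairDilation_flow_of_notMem hkj hkl s x (by tauto), diffC_apply]
  rw [area, h1, h2, mul_assoc, Complex.im_ofReal_mul, area]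

theorem area_eq_zero_of_eq {i m : Fin N} {x : Config N} (h : x i = x m) : area k i m x = 0 := by
  rw [area, diffC_apply, diffC_apply, h, Complex.mul_conj]
  exact Complex.ofReal_im _

/-- A dilated particle stays on its ray from `x k`, so it could meet a fixed particle other than `k`
only if collinear with it and `k`. The areas are merely scaled by `exp s` and remain nonzero. -/
theorem pairDilation_mem_generic (hkj : k ≠ j) (hkl : k ≠ l) (s : ℝ) {x : Config N}
    (hx : x ∈ generic j l k) : (pairDilation hkj hkl).flow s x ∈ generic j l k := by
  have hexp := (Real.exp_pos s).ne'
  set y := (pairDilation hkj hkl).flow s x with hy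
  have hcr : ∀ i, (i = j ∨ i = l) → ∀ m, ¬(m = j ∨ m = l) → m ≠ k → area k i m y ≠ 0 := by
    intro i hi m hm hk
    rw [hy, area_pairDilation hkj hkl s x hi hm]
    exact mul_ne_zero hexp (hx.2 i hi m hm hk)
  refine ⟨?_, hcr⟩
  have hmix : ∀ p q, (p = j ∨ p = l) → ¬(q = j ∨ q = l) → y p ≠ y q := by
    intro p q hp hq h
    by_cases hqk : q = k
    · subst hqk
      have h1 := pairDilation_flow_sub hkj hkl s x hp
      rw [← hy, h, sub_self] at h1
      have h2 := (smul_eq_zero.1 h1.symm).resolve_left hexp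
      exact hx.1 ⟨p, q, by rintro rfl; exact hq hp, sub_eq_zero.1 h2⟩
    · exact hcr p hp q hq hqk (area_eq_zero_of_eq h)
  rintro ⟨p, q, hpq, h⟩
  by_cases hp : p = j ∨ p = l
  · by_cases hq : q = j ∨ q = l
    · rw [hy, pairDilation_flow_of_mem hkj hkl s x hp, pairDilation_flow_of_mem hkj hkl s x hq] at h
      have h1 := smul_right_injective Plane hexp (add_left_cancel h)
      exact hx.1 ⟨p, q, hpq, sub_left_injective h1⟩
    · exact hmix p q hp hq h
  · by_cases hq : q = j ∨ q = l
    · exact hmix q p hq hp h.symm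
    · rw [hy, pairDilation_flow_of_notMem hkj hkl s x hp,
        pairDilation_flow_of_notMem hkj hkl s x hq] at h
      exact hx.1 ⟨p, q, hpq, h⟩

/-- The factors whose arguments make up the gauge transformation for the dilation of a pair. -/
noncomputable def dilationFactor (k : Fin N) (p : Fin N × Fin N) (x : Config N) : ℂ :=
  1 - (diffC k p.2 x / diffC k p.1 x) ^ 1

theorem diffC_ne_zero_of_area {i m : Fin N} {x : Config N} (h : area k i m x ≠ 0) :
    diffC k m x ≠ 0 := by
  intro h0
  exact h (by simp [area, h0])

/-- The area is a positive multiple of the imaginary part of the quotient of the two displacements,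
so the factor is not real. -/
theorem dilationFactor_mem_slitPlane {i m : Fin N} {x : Config N} (h : area k i m x ≠ 0) :
    dilationFactor k (m, i) x ∈ Complex.slitPlane := by
  rw [Complex.mem_slitPlane_iff]
  right
  simp only [dilationFactor, pow_one, Complex.sub_im, Complex.one_im, zero_sub, neg_ne_zero]
  intro h0
  apply h
  have hm := diffC_ne_zero_of_area h
  have h1 : diffC k i x * (starRingEnd ℂ) (diffC k m x) =
      (Complex.normSq (diffC k m x) : ℂ) * (diffC k i x / diffC k m x) := by
    rw [← Complex.mul_conj]
    field_simp
  rw [area, h1, Complex.im_ofReal_mul, h0, mul_zero]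

/-- The index set of the gauge factors for the dilation of a pair. -/
def dilationIndices (j l k : Fin N) : Finset (Fin N × Fin N) :=
  (Finset.univ \ {j, l, k}) ×ˢ {j, l}

theorem area_ne_zero_of_mem {x : Config N} (hx : x ∈ generic j l k) {p : Fin N × Fin N}
    (hp : p ∈ dilationIndices j l k) : area k p.2 p.1 x ≠ 0 := by
  simp only [dilationIndices, Finset.mem_product, Finset.mem_sdiff, Finset.mem_univ, true_and,
    Finset.mem_insert, Finset.mem_singleton, not_or] at hp
  exact hx.2 p.2 hp.2 p.1 (by tauto) hp.1.2.2

/-- Radial motion sees no field from the centre, since `Im 1 = 0`, and the mutual terms of the pair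
also sum to `Im 1`. For a fourth particle `m`, the factor is `(x_m - x_i) / (x_m - x_k)` with fixed
denominator, so its argument has the right derivative. -/
theorem potentialAlong_pairDilation (hjl : j ≠ l) (hkj : k ≠ j) (hkl : k ≠ l) {x : Config N}
    (hx : x ∈ generic j l k) :
    potentialAlong (pairDilation hkj hkl).gen x = ∑ p ∈ dilationIndices j l k,
      (fderiv ℝ (dilationFactor k p) x ((pairDilation hkj hkl).gen x) /
        dilationFactor k p x).im := by
  have hj : j = j ∨ j = l := Or.inl rfl
  have hl : l = j ∨ l = l := Or.inr rfl
  rw [potentialAlong_of_pair hjl _ _ fun i hj hl => by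
    rw [pairDilation_gen, pairFrom_of_notMem (by tauto)]]
  rw [pairDilation_gen, pairFrom_of_mem hj, pairFrom_of_mem hl]
  have hS : Finset.univ \ {j, l} = insert k (Finset.univ \ {j, l, k} : Finset (Fin N)) := by
    ext m
    simp only [Finset.mem_sdiff, Finset.mem_univ, true_and, Finset.mem_insert,
      Finset.mem_singleton, not_or]
    by_cases hm : m = k
    · subst hm; simp [hkj, hkl]
    · simp [hm]
  rw [hS, Finset.sum_insert (by simp), dilationIndices, Finset.sum_product]
  have hnz : ∀ p q : Fin N, p ≠ q → toC (x p - x q) ≠ 0 := fun p q hpq => by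
    rw [Ne, toC_eq_zero, sub_eq_zero]
    exact fun h => hx.1 ⟨p, q, hpq, h⟩
  have e1 : (toC (x j - x k) / toC (x j - x l)).im + (toC (x l - x k) / toC (x l - x j)).im = 0 := by
    have h1 : toC (x l - x j) = -toC (x j - x l) := by rw [← map_neg, neg_sub]
    have h2 : toC (x j - x k) - toC (x l - x k) = toC (x j - x l) := by
      rw [← map_sub]; congr 1; abel
    rw [← Complex.add_im, h1, div_neg, ← sub_eq_add_neg, ← sub_div, h2, div_self (hnz j l hjl),
      Complex.one_im]
  rw [e1, div_self (hnz j k hkj.symm), div_self (hnz l k hkl.symm), Complex.one_im, add_zero,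
    zero_add, zero_add]
  refine Finset.sum_congr rfl fun m hm => ?_
  have hm' : m ≠ j ∧ m ≠ l ∧ m ≠ k := by simpa using hm
  rw [Finset.sum_pair hjl]
  have key : ∀ i, (i = j ∨ i = l) → (toC (x i - x k) / toC (x i - x m)).im =
      (fderiv ℝ (dilationFactor k (m, i)) x (pairFrom j l k x) / dilationFactor k (m, i) x).im := by
    intro i hi
    have har := hx.2 i hi m (by tauto) hm'.2.2
    have hc := diffC_ne_zero_of_area har
    have hgen : diffC k m (pairFrom j l k x) = 0 := by
      rw [diffC_apply, pairFrom_of_notMem (by tauto), pairFrom_of_notMem (by tauto)]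
      simp
    have hgen' : diffC k i (pairFrom j l k x) = diffC k i x := by
      rw [diffC_apply, pairFrom_of_mem hi, pairFrom_of_notMem (by tauto), sub_zero, diffC_apply]
    have hder : fderiv ℝ (dilationFactor k (m, i)) x (pairFrom j l k x) = _ :=
      fderiv_gaugeFactor (diffC k i) (diffC k m) 1 hc hgen
    have e2 : toC (x i - x m) = diffC k i x - diffC k m x := by
      rw [diffC_apply, diffC_apply, ← map_sub]; congr 1; abel
    have him : i ≠ m := by rintro rfl; tauto
    have h3 : diffC k i x - diffC k m x ≠ 0 := e2 ▸ hnz i m him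
    rw [hder, hgen', e2, dilationFactor, ← diffC_apply]
    congr 1
    have h4 : diffC k m x - diffC k i x ≠ 0 := by rwa [← neg_sub, neg_ne_zero]
    have h5 : 1 - (diffC k i x / diffC k m x) ^ 1 =
        (diffC k m x - diffC k i x) / diffC k m x := by field_simp
    rw [h5, show (1 - 1 : ℕ) = 0 from rfl, pow_zero]
    field_simp
    push_cast
    ring
  rw [key j hj, key l hl]

/-- The dilation of two particles about a third one, on the generic configurations. -/
noncomputable def dilationGaugedFlow (α : ℝ) (hjl : j ≠ l) (hkj : k ≠ j) (hkl : k ≠ l) :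
    GaugedFlow N α where
  Φ := pairDilation hkj hkl
  δ := 4
  divergence_eq := divergence_pairDilation hjl hkj hkl
  U := generic j l k
  isOpen := isOpen_generic
  subset := fun x hx => hx.1
  invariant := fun s x hx => pairDilation_mem_generic hkj hkl s hx
  g := gaugePhase α (dilationIndices j l k) (dilationFactor k)
  measurable := measurable_gaugePhase α _ fun p => by
    unfold dilationFactor
    fun_prop
  norm_eq_one := norm_gaugePhase α _ _
  contDiffOn := contDiffOn_gaugePhase α
    (fun p hp x hx => (contDiffAt_gaugeFactor _ _ 1
      (diffC_ne_zero_of_area (area_ne_zero_of_mem hx hp))).contDiffWithinAt)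
    fun p hp x hx => dilationFactor_mem_slitPlane (area_ne_zero_of_mem hx hp)
  c := 0
  gauge := by
    intro x hx
    rw [fderiv_gaugePhase α (u := dilationFactor k) (fun p hp => (contDiffAt_gaugeFactor _ _ 1
      (diffC_ne_zero_of_area (area_ne_zero_of_mem hx hp))).differentiableAt (by simp))
      fun p hp => dilationFactor_mem_slitPlane (area_ne_zero_of_mem hx hp),
      potentialAlong_pairDilation hjl hkj hkl hx]
    push_cast
    linear_combination (α * (∑ p ∈ dilationIndices j l k,
      ((fderiv ℝ (dilationFactor k p) x ((pairDilation hkj hkl).gen x) /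
        dilationFactor k p x).im : ℂ)) *
      gaugePhase α (dilationIndices j l k) (dilationFactor k) x) * Complex.I_sq
  W := fun x => ‖x j - x k‖ ^ 2 + ‖x l - x k‖ ^ 2
  contDiff_weight := (ContDiff.norm_sq ℝ (by fun_prop)).add (ContDiff.norm_sq ℝ (by fun_prop))
  weight_nonneg := fun x => by positivity
  weight_pos := fun x hx => by
    have : x j - x k ≠ 0 := sub_ne_zero.2 fun h => hx.1 ⟨j, k, hkj.symm, h⟩
    positivity

theorem setLIntegral_generic_le (hjl : j ≠ l) (hkj : k ≠ j) (hkl : k ≠ l) {α : ℝ}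
    {φ : Config N → ℂ} (hφ : MemLp φ 2 volume)
    {G : Fin N → Config N → EuclideanSpace ℂ (Fin 2)} (hG : ∀ j, MemLp (G j) 2 volume)
    (hD : ∀ j, IsMagneticDeriv α j φ (G j)) :
    ∫⁻ x in generic j l k,
        ENNReal.ofReal (‖φ x‖ ^ 2 / (‖x j - x k‖ ^ 2 + ‖x l - x k‖ ^ 2)) ≤
      ENNReal.ofReal ((∫ x, ‖G j x‖ ^ 2) + ∫ x, ‖G l x‖ ^ 2) := by
  set Γ := dilationGaugedFlow α hjl hkj hkl with hΓ
  have hi : ∀ i, Integrable fun x => ‖G i x‖ ^ 2 := fun i =>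
    (memLp_two_iff_integrable_sq_norm (hG i).1).1 (hG i)
  have hi0 : ∀ i, 0 ≤ ∫ x, ‖G i x‖ ^ 2 := fun i => integral_nonneg fun x => by positivity
  have h := setLIntegral_sq_div_le_of_pairing_le volume Γ.isOpen (Γ.memLp_mul_gauge hφ)
    Γ.contDiff_weight Γ.weight_pos (add_nonneg (hi0 j) (hi0 l)) fun ψ hψ => ?_
  · simpa [Γ.norm_eq_one] using! h
  -- Here the squared displacements sum exactly to the weight, so no constant appears.
  have hR : ∀ x, ‖derivAlong Γ.Φ.gen G x‖ ^ 2 ≤ Γ.W x * (‖G j x‖ ^ 2 + ‖G l x‖ ^ 2) := by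
    intro x
    have h1 := norm_derivAlong_sq_le_of_pair hjl (pairDilation hkj hkl).gen G x
      fun i hj hl => by rw [pairDilation_gen, pairFrom_of_notMem (by tauto)]
    rw [pairDilation_gen, pairFrom_of_mem (Or.inl rfl), pairFrom_of_mem (Or.inr rfl)] at h1
    exact h1
  have key := Γ.norm_pairing_sq_le_of_dilation rfl rfl (fun s x => ?_) hφ hG hD
    (R := fun x => ‖G j x‖ ^ 2 + ‖G l x‖ ^ 2) (fun x => by positivity) ((hi j).add (hi l)) hR hψ
  · rwa [integral_add (hi j) (hi l)] at key
  · change ‖(pairDilation hkj hkl).flow s x j - (pairDilation hkj hkl).flow s x k‖ ^ 2 +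
      ‖(pairDilation hkj hkl).flow s x l - (pairDilation hkj hkl).flow s x k‖ ^ 2 =
      Real.exp (2 * s) * (‖x j - x k‖ ^ 2 + ‖x l - x k‖ ^ 2)
    rw [pairDilation_flow_sub hkj hkl s x (Or.inl rfl),
      pairDilation_flow_sub hkj hkl s x (Or.inr rfl), norm_smul, norm_smul, Real.norm_eq_abs,
      Real.abs_exp, two_mul, Real.exp_add]
    ring

end Dilation

/-! ### The excluded configurations are null sets -/

section NullSets

/-- An open set holds almost everywhere if it does so on each line in a fixed direction. -/
theorem ae_mem_of_ae_line {U : Set (Config N)} (hU : IsOpen U) (v : Config N)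
    (h : ∀ y, ∀ᵐ t : ℝ, y + t • v ∈ U) : ∀ᵐ x : Config N, x ∈ U := by
  refine ae_mem_of_ae_add_linearMap_mem (LinearMap.toSpanSingleton ℝ (Config N) v) volume volume
    hU.measurableSet fun y => ?_
  simpa using h y

theorem ae_apply_ne {p q : Fin N} (hpq : p ≠ q) : ∀ᵐ x : Config N, x p ≠ x q := by
  refine ae_mem_of_ae_line (U := {x | x p ≠ x q})
    (isOpen_ne_fun (continuous_apply p) (continuous_apply q))
    (Pi.single p (EuclideanSpace.single 0 1)) fun y => ?_
  refine (Set.countable_singleton (y q 0 - y p 0)).ae_notMem volume |>.mono fun t ht h => ht ?_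
  have h1 := congrArg (fun w : Plane => w 0) h
  simp [hpq.symm] at h1
  rw [Set.mem_singleton_iff]
  linarith

theorem ae_notMem_diagonals : ∀ᵐ x : Config N, x ∉ diagonals N := by
  have h : ∀ᵐ x : Config N, ∀ p q : Fin N, p ≠ q → x p ≠ x q :=
    ae_all_iff.2 fun p => ae_all_iff.2 fun q =>
      Filter.eventually_imp_distrib_left.2 fun hpq => ae_apply_ne hpq
  filter_upwards [h] with x hx
  rintro ⟨p, q, hpq, h⟩
  exact hx p q hpq h

theorem ae_quadratic_ne_zero (b c : ℝ) : ∀ᵐ t : ℝ, t ^ 2 + b * t + c ≠ 0 := by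
  set d := √(b ^ 2 / 4 - c)
  have hfin : ({-b / 2 + d, -b / 2 - d} : Set ℝ).Countable :=
    (Set.toFinite _).countable
  refine hfin.ae_notMem volume |>.mono fun t ht h => ht ?_
  have h1 : (t + b / 2) ^ 2 = b ^ 2 / 4 - c := by linarith
  have h2 : d ^ 2 = b ^ 2 / 4 - c := Real.sq_sqrt (h1 ▸ sq_nonneg _)
  rcases sq_eq_sq_iff_eq_or_eq_neg.1 (h1.trans h2.symm) with h3 | h3
  · left; linarith
  · right; rw [Set.mem_singleton_iff]; linarith

theorem ae_area_ne_zero {k i m : Fin N} (hik : i ≠ k) (hmk : m ≠ k) (him : i ≠ m) :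
    ∀ᵐ x : Config N, area k i m x ≠ 0 := by
  refine ae_mem_of_ae_line (U := {x | area k i m x ≠ 0})
    (isOpen_ne_fun (continuous_area i m) continuous_const)
    -- Moving `i` and `m` in perpendicular directions makes the area a quadratic in `t` with leading
    -- coefficient `-1`, hence with at most two zeros on every such line.
    (Pi.single i (EuclideanSpace.single 0 1) + Pi.single m (EuclideanSpace.single 1 1))
    fun y => ?_
  set a := diffC k i y with ha
  set c := diffC k m y with hc
  have h1 : diffC k i (Pi.single i (EuclideanSpace.single 0 1) +
      Pi.single m (EuclideanSpace.single 1 1)) = 1 := by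
    rw [diffC_apply, toC_apply]
    simp [him, hik.symm, hmk.symm]
  have h2 : diffC k m (Pi.single i (EuclideanSpace.single 0 1) +
      Pi.single m (EuclideanSpace.single 1 1)) = Complex.I := by
    rw [diffC_apply, toC_apply]
    simp [him.symm, hik.symm, hmk.symm]
  filter_upwards [ae_quadratic_ne_zero (a.re + c.im) (-(a.im * c.re - a.re * c.im))] with t ht h0
  refine ht ?_
  rw [area, map_add, map_add, map_smul, map_smul, h1, h2, ← ha, ← hc] at h0
  simp at h0
  linarith

theorem ae_mem_generic (j l k : Fin N) (hkj : k ≠ j) (hkl : k ≠ l) :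
    ∀ᵐ x : Config N, x ∈ generic j l k := by
  have h : ∀ᵐ x : Config N, ∀ i m : Fin N, i ≠ k ∧ m ≠ k ∧ i ≠ m → area k i m x ≠ 0 :=
    ae_all_iff.2 fun i => ae_all_iff.2 fun m => Filter.eventually_imp_distrib_left.2 fun him =>
      ae_area_ne_zero him.1 him.2.1 him.2.2
  filter_upwards [h, ae_notMem_diagonals] with x hx hd
  refine ⟨hd, fun i hi m hm hmk => hx i m ⟨?_, hmk, ?_⟩⟩
  · rintro rfl; tauto
  · rintro rfl; tauto

end NullSets

/-! ### Positivity of the Hardy constant -/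

section HardyConst

/-- Equality would make `α` an even integer, and there is none strictly between `0` and `2`. -/
theorem exp_ne_one {α : ℝ} (hα : α ∈ Set.Ioo (0 : ℝ) 2) :
    Complex.exp (-(Complex.I * α * Real.pi)) ≠ 1 := by
  intro h
  obtain ⟨n, hn⟩ := Complex.exp_eq_one_iff.1 h
  have h1 : -(α * Real.pi) = n * (2 * Real.pi) := by
    have := congrArg Complex.im hn
    simpa using this
  have h2 : -α = 2 * n := by
    have hpi := Real.pi_pos.ne'
    have : Real.pi * -α = Real.pi * (2 * n) := by linarith
    exact mul_left_cancel₀ hpi this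
  have h3 : (-1 : ℝ) < n := by linarith [hα.2]
  have h4 : (n : ℝ) < 0 := by linarith [hα.1]
  have h5 : (-1 : ℤ) < n := by exact_mod_cast h3
  have h6 : n < 0 := by exact_mod_cast h4
  omega

theorem iInf_le_sq (α : ℝ) (q : ℤ) :
    (⨅ q : ℤ, |α - 2 * (q : ℝ)| ^ 2) ≤ |α - 2 * (q : ℝ)| ^ 2 :=
  ciInf_le ⟨0, by rintro _ ⟨q, rfl⟩; positivity⟩ q

theorem iInf_sq_pos {α : ℝ} (hα : α ∈ Set.Ioo (0 : ℝ) 2) :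
    0 < ⨅ q : ℤ, |α - 2 * (q : ℝ)| ^ 2 := by
  have hmin : 0 < min α (2 - α) := lt_min hα.1 (by linarith [hα.2])
  refine (pow_pos hmin 2).trans_le (le_ciInf fun q => pow_le_pow_left₀ hmin.le ?_ 2)
  rcases le_or_gt q 0 with hq | hq
  · have : (q : ℝ) ≤ 0 := by exact_mod_cast hq
    exact (min_le_left _ _).trans (le_trans (by linarith) (le_abs_self _))
  · have : (1 : ℝ) ≤ q := by exact_mod_cast hq
    exact (min_le_right _ _).trans (le_trans (by linarith) (neg_le_abs _))

end HardyConst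

/-! ### The estimate for one pair -/

section PairBound

variable {j l : Fin N}

/-- If particle `k` lies in the disc between `j` and `l`, then the angle at `k` is obtuse. -/
theorem sq_add_sq_le_of_mem_disc {k : Fin N} {x : Config N}
    (h : ‖x k - midpt j l x‖ ≤ ‖halfDiff j l x‖) :
    ‖x j - x k‖ ^ 2 + ‖x l - x k‖ ^ 2 ≤ ‖x j - x l‖ ^ 2 := by
  set w := x k - midpt j l x with hw
  set z := halfDiff j l x with hz
  have h1 : x j - x k = z - w := by
    rw [hw, hz]; nth_rewrite 1 [eq_midpt_add (j := j) (l := l) x]; abel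
  have h2 : x l - x k = -(z + w) := by
    rw [hw, hz]; nth_rewrite 1 [eq_midpt_sub (j := j) (l := l) x]; abel
  have h3 : ‖x j - x l‖ = 2 * ‖z‖ := by rw [hz, norm_halfDiff]; ring
  -- The sum of squares is `2 ‖z‖² + 2 ‖w‖²`, and `‖w‖ ≤ ‖z‖` bounds it by `4 ‖z‖²`.
  have h4 := parallelogram_law_with_norm ℝ z w
  rw [h1, h2, h3, norm_neg]
  have h5 := mul_self_le_mul_self (norm_nonneg w) h
  nlinarith

/-- The term `(hardyConst α)⁻¹` pays for configurations with an empty disc. Each of the `N - 2`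
other particles costs one four-dimensional Hardy inequality for the configurations where it lies in
the disc. -/
theorem lintegral_pair_le (hjl : j ≠ l) {α : ℝ} (hα : α ∈ Set.Ioo (0 : ℝ) 2) {φ : Config N → ℂ}
    (hφ : IsSymmetricL2 φ) {G : Fin N → Config N → EuclideanSpace ℂ (Fin 2)}
    (hG : ∀ j, MemLp (G j) 2 volume) (hD : ∀ j, IsMagneticDeriv α j φ (G j)) :
    ∫⁻ x, ENNReal.ofReal (‖φ x‖ ^ 2 / ‖x j - x l‖ ^ 2) ≤
      ENNReal.ofReal (((hardyConst α)⁻¹ + ((N : ℝ) - 2)) *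
        ((∫ x, ‖G j x‖ ^ 2) + ∫ x, ‖G l x‖ ^ 2)) := by
  set e := (∫ x, ‖G j x‖ ^ 2) + ∫ x, ‖G l x‖ ^ 2 with he
  have he0 : 0 ≤ e := add_nonneg (integral_nonneg fun x => by positivity)
    (integral_nonneg fun x => by positivity)
  set S : Finset (Fin N) := Finset.univ \ {j, l} with hS
  have hmemS : ∀ k ∈ S, k ≠ j ∧ k ≠ l := fun k hk => by simpa [hS] using hk
  have hcard : (S.card : ℝ) = (N : ℝ) - 2 := by
    rw [hS, Finset.card_sdiff_of_subset (Finset.subset_univ _), Finset.card_univ, Fintype.card_fin,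
      Finset.card_pair hjl, Nat.cast_sub]
    · norm_num
    · have := Finset.card_le_univ ({j, l} : Finset (Fin N))
      rwa [Finset.card_pair hjl, Fintype.card_fin] at this
  set F : Config N → ENNReal := fun x => ENNReal.ofReal (‖φ x‖ ^ 2 / ‖x j - x l‖ ^ 2) with hF
  set B : Fin N → Config N → ENNReal := fun k x =>
    ENNReal.ofReal (‖φ x‖ ^ 2 / (‖x j - x k‖ ^ 2 + ‖x l - x k‖ ^ 2)) with hB
  have hφm : AEMeasurable (fun x => ‖φ x‖ ^ 2) volume := hφ.memLp.1.aemeasurable.norm.pow_const 2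
  have hBm : ∀ k, AEMeasurable (B k) volume := fun k =>
    (hφm.div (Continuous.aemeasurable (by fun_prop))).ennreal_ofReal
  have hFm : AEMeasurable F volume :=
    (hφm.div (Continuous.aemeasurable (by fun_prop))).ennreal_ofReal
  -- When the disc is occupied, the term of a single occupant already dominates `F`; the rest of the
  -- sum is nonnegative.
  have hpt : ∀ᵐ x : Config N, F x ≤ (emptyDisc j l).indicator F x +
      ∑ k ∈ S, (generic j l k).indicator (B k) x := by
    have hgen : ∀ᵐ x : Config N, ∀ k : Fin N, k ≠ j ∧ k ≠ l → x ∈ generic j l k :=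
      ae_all_iff.2 fun k => Filter.eventually_imp_distrib_left.2 fun hk =>
        ae_mem_generic j l k hk.1 hk.2
    filter_upwards [hgen, ae_notMem_diagonals] with x hx hd
    by_cases hxe : x ∈ emptyDisc j l
    · rw [Set.indicator_of_mem hxe]
      exact le_self_add
    · have : ∃ k, k ≠ j ∧ k ≠ l ∧ ‖x k - midpt j l x‖ ≤ ‖halfDiff j l x‖ := by
        by_contra hcon
        push Not at hcon
        exact hxe ⟨hd, hcon⟩
      obtain ⟨k, hkj, hkl, hk⟩ := this
      have hkS : k ∈ S := by simp [hS, hkj, hkl]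
      have h1 : F x ≤ (generic j l k).indicator (B k) x := by
        rw [Set.indicator_of_mem (hx k ⟨hkj, hkl⟩)]
        refine ENNReal.ofReal_le_ofReal ?_
        have hpos : 0 < ‖x j - x k‖ ^ 2 + ‖x l - x k‖ ^ 2 := by
          have : x j - x k ≠ 0 := sub_ne_zero.2 fun h => hd ⟨j, k, hkj.symm, h⟩
          positivity
        exact div_le_div_of_nonneg_left (by positivity) hpos (sq_add_sq_le_of_mem_disc hk)
      refine h1.trans (le_trans ?_ le_add_self)
      exact Finset.single_le_sum (f := fun k => (generic j l k).indicator (B k) x)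
        (fun _ _ => zero_le) hkS
  have hC : 2 * (⨅ q : ℤ, |α - 2 * (q : ℝ)| ^ 2) = hardyConst α := rfl
  have hCpos : 0 < hardyConst α := by
    have := iInf_sq_pos hα
    rw [← hC]; positivity
  calc ∫⁻ x, F x ≤ ∫⁻ x, ((emptyDisc j l).indicator F x +
        ∑ k ∈ S, (generic j l k).indicator (B k) x) := lintegral_mono_ae hpt
    _ = (∫⁻ x in emptyDisc j l, F x) + ∑ k ∈ S, ∫⁻ x in generic j l k, B k x := by
        rw [lintegral_add_left' (hFm.indicator isOpen_emptyDisc.measurableSet),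
          lintegral_finsetSum' _ fun k _ => (hBm k).indicator isOpen_generic.measurableSet,
          lintegral_indicator isOpen_emptyDisc.measurableSet]
        congr 1
        exact Finset.sum_congr rfl fun k _ => lintegral_indicator isOpen_generic.measurableSet _
    _ ≤ ENNReal.ofReal ((hardyConst α)⁻¹ * e) + ∑ k ∈ S, ENNReal.ofReal e := by
        refine add_le_add ?_ (Finset.sum_le_sum fun k hk => ?_)
        · rw [← hC]
          exact setLIntegral_emptyDisc_le hjl (iInf_sq_pos hα) (iInf_le_sq α) (exp_ne_one hα) hφ hG hD
        · exact setLIntegral_generic_le hjl (hmemS k hk).1 (hmemS k hk).2 hφ.memLp hG hD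
    _ = _ := by
        rw [Finset.sum_const, nsmul_eq_mul, ← ENNReal.ofReal_natCast,
          ← ENNReal.ofReal_mul (Nat.cast_nonneg _), ← ENNReal.ofReal_add (by positivity)
          (by positivity), hcard, add_mul]

end PairBound

/-! ### Summation over pairs and conclusion -/

theorem sum_Ioi_add (E : Fin N → ℝ) :
    ∑ j : Fin N, ∑ l ∈ Finset.Ioi j, (E j + E l) = ((N : ℝ) - 1) * ∑ k, E k := by
  have h1 : ∑ j : Fin N, ∑ l ∈ Finset.Ioi j, E l = ∑ l : Fin N, ∑ j ∈ Finset.Iio l, E l :=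
    Finset.sum_comm' (by simp)
  simp_rw [Finset.sum_add_distrib]
  rw [h1]
  simp only [Finset.sum_const, Fin.card_Ioi, Fin.card_Iio, nsmul_eq_mul]
  rw [← Finset.sum_add_distrib, Finset.mul_sum]
  refine Finset.sum_congr rfl fun i _ => ?_
  have : ((N - 1 - (i : ℕ) : ℕ) : ℝ) + (i : ℕ) = (N : ℝ) - 1 := by
    have hi := i.isLt
    have h2 : (N - 1 - (i : ℕ)) + (i : ℕ) + 1 = N := by omega
    have h3 : (((N - 1 - (i : ℕ)) + (i : ℕ) + 1 : ℕ) : ℝ) = N := by rw [h2]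
    push_cast at h3
    linarith
  rw [← add_mul, this]

end Anyon

theorem theorem2p3 (N : ℕ) (hN : 2 ≤ N) (α : ℝ) (hα : α ∈ Set.Ioo (0 : ℝ) 2)
    (φ : Anyon.Config N → ℂ) (hφ : Anyon.IsSymmetricL2 φ)
    (Dφ : Fin N → Anyon.Config N → EuclideanSpace ℂ (Fin 2))
    (hD : ∀ j, Anyon.IsMagneticDeriv α j φ (Dφ j))
    (hDL2 : ∀ j, MemLp (Dφ j) 2 volume) :
    (∀ j l : Fin N, j < l → Integrable (fun x => ‖φ x‖ ^ 2 / ‖x j - x l‖ ^ 2) volume) ∧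
    2 * Anyon.hardyConst α /
          (((N : ℝ) - 1) * (2 + 3 * ((N : ℝ) - 2) * Anyon.hardyConst α)) *
        ∑ j : Fin N, ∑ l ∈ Finset.Ioi j, ∫ x, ‖φ x‖ ^ 2 / ‖x j - x l‖ ^ 2 ≤
      ∑ k : Fin N, ∫ x, ‖Dφ k x‖ ^ 2 := by
  have hC : 0 < Anyon.hardyConst α := by
    have := Anyon.iInf_sq_pos hα
    rw [Anyon.hardyConst]; positivity
  have hN' : (2 : ℝ) ≤ N := by exact_mod_cast hN
  set C := Anyon.hardyConst α
  set e : Fin N → ℝ := fun k => ∫ x, ‖Dφ k x‖ ^ 2 with he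
  have he0 : ∀ k, 0 ≤ e k := fun k => integral_nonneg fun x => by positivity
  have hmeas : ∀ j l : Fin N, AEStronglyMeasurable
      (fun x : Anyon.Config N => ‖φ x‖ ^ 2 / ‖x j - x l‖ ^ 2) volume := fun j l =>
    ((hφ.memLp.1.aemeasurable.norm.pow_const 2).div
      (Continuous.aemeasurable (by fun_prop))).aestronglyMeasurable
  have hnonneg : ∀ j l : Fin N, ∀ᵐ x : Anyon.Config N, 0 ≤ ‖φ x‖ ^ 2 / ‖x j - x l‖ ^ 2 :=
    fun j l => Filter.Eventually.of_forall fun x => by positivity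
  have hpair : ∀ j l : Fin N, j < l →
      ∫⁻ x, ENNReal.ofReal (‖φ x‖ ^ 2 / ‖x j - x l‖ ^ 2) ≤
        ENNReal.ofReal ((C⁻¹ + ((N : ℝ) - 2)) * (e j + e l)) := fun j l hjl =>
    Anyon.lintegral_pair_le hjl.ne hα hφ hDL2 hD
  have hconst : 0 ≤ C⁻¹ + ((N : ℝ) - 2) := by
    have := inv_pos.2 hC
    linarith
  refine ⟨fun j l hjl => ⟨hmeas j l, ?_⟩, ?_⟩
  -- The pair bound is stated for the extended nonnegative integral, so it yields integrability as
  -- well as the inequality.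
  · rw [hasFiniteIntegral_iff_ofReal (hnonneg j l)]
    exact (hpair j l hjl).trans_lt ENNReal.ofReal_lt_top
  · have hle : ∀ j l : Fin N, j < l → ∫ x, ‖φ x‖ ^ 2 / ‖x j - x l‖ ^ 2 ≤
        (C⁻¹ + ((N : ℝ) - 2)) * (e j + e l) := by
      intro j l hjl
      rw [integral_eq_lintegral_of_nonneg_ae (hnonneg j l) (hmeas j l)]
      exact ENNReal.toReal_le_of_le_ofReal (mul_nonneg hconst (add_nonneg (he0 j) (he0 l)))
        (hpair j l hjl)
    have hsum : ∑ j : Fin N, ∑ l ∈ Finset.Ioi j, ∫ x, ‖φ x‖ ^ 2 / ‖x j - x l‖ ^ 2 ≤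
        (C⁻¹ + ((N : ℝ) - 2)) * (((N : ℝ) - 1) * ∑ k, e k) := by
      rw [← Anyon.sum_Ioi_add, Finset.mul_sum]
      simp_rw [Finset.mul_sum]
      exact Finset.sum_le_sum fun j _ => Finset.sum_le_sum fun l hl =>
        hle j l (Finset.mem_Ioi.1 hl)
    have hE : 0 ≤ ∑ k, e k := Finset.sum_nonneg fun k _ => he0 k
    have hden : 0 < ((N : ℝ) - 1) * (2 + 3 * ((N : ℝ) - 2) * C) := by
      have : 0 ≤ 3 * ((N : ℝ) - 2) * C := by
        have : 0 ≤ (N : ℝ) - 2 := by linarith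
        positivity
      exact mul_pos (by linarith) (by linarith)
    rw [div_mul_eq_mul_div, div_le_iff₀ hden]
    calc 2 * C * ∑ j : Fin N, ∑ l ∈ Finset.Ioi j, ∫ x, ‖φ x‖ ^ 2 / ‖x j - x l‖ ^ 2
        ≤ 2 * C * ((C⁻¹ + ((N : ℝ) - 2)) * (((N : ℝ) - 1) * ∑ k, e k)) := by gcongr
      _ = (∑ k, e k) * (((N : ℝ) - 1) * (2 + 2 * ((N : ℝ) - 2) * C)) := by
          field_simp
      -- The coefficient `3` is slack: the pair bounds already give `2`.
      _ ≤ (∑ k, e k) * (((N : ℝ) - 1) * (2 + 3 * ((N : ℝ) - 2) * C)) := by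
          refine mul_le_mul_of_nonneg_left (mul_le_mul_of_nonneg_left ?_ (by linarith)) hE
          have : 0 ≤ ((N : ℝ) - 2) * C := mul_nonneg (by linarith) hC.le
          linarith
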